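/- Let $p\in\mathbb N=\{1,2,\dots\}$, let $X=\mathbb C^p$ with the Euclidean norm, let $E=\ell^2(\mathbb Z,X)$, and let $A\in L(E)$ be a bounded linear operator with matrix representation $[a_{i,j}]_{i,j\in\mathbb Z}$, $a_{i,j}\in L(X)$. Suppose that $A$ is tridiagonal ($a_{i,j}=0$ for $|i-j|>1$) and block-Laurent (each diagonal is constant, i.e. $a_{j+d,j}$ does not depend on $j$, for every $d\in\mathbb Z$). Write $\alpha_j=a_{j+1,j}$, $\gamma_j=a_{j-1,j}$, $\|\alpha\|_\infty=\sup_j\|\alpha_j\|$, $\|\gamma\|_\infty=\sup_j\|\gamma_j\|$, $\mathbb T=\{t\in\mathbb C:|t|=1\}$. Notation. For a bounded operator $B$ on a complex normed space put $\|B^{-1}\|:=\infty$ if $B$ is not invertible, and $1/\infty:=0$. Let $\mathrm{Spec}\,B$ be the spectrum, $\mathrm{Spec}_0B:=\mathrm{Spec}\,B$, and for $\varepsilon>0$ $$\mathrm{Spec}_\varepsilon B=\{\lambda\in\mathbb C: 1/\|(B-\lambda I)^{-1}\|\le\varepsilon\},\qquad \mathrm{spec}_\varepsilon B=\{\lambda\in\mathbb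 C: 1/\|(B-\lambda I)^{-1}\|<\varepsilon\}.$$ For $n\in\mathbb N$, $k\in\mathbb Z$, $t\in\mathbb T$, let $A^{\mathrm{per},t}_{n,k}$ be the $n\times n$ matrix with entries in $L(X)$ whose $(i,j)$ entry, $1\le i,j\le n$, is $$a_{k+i,k+j}+\delta_{i,1}\delta_{j,n}\,t\,\alpha_k+\delta_{i,n}\delta_{j,1}\,\bar t\,\gamma_{k+n+1},$$ acting on $X^n$ with the norm $(\sum_{i}\|x_i\|^2)^{1/2}$. Let $$\Pi^{n,t}_\varepsilon(A)=\overline{\bigcup_{k\in\mathbb Z}\mathrm{Spec}_\varepsilon A^{\mathrm{per},t}_{n,k}}\ \ (\varepsilon\ge0),\qquad \pi^{n,t}_\varepsilon(A)=\bigcup_{k\in\mathbb Z}\mathrm{spec}_\varepsilon A^{\mathrm{per},t}_{n,k}\ \ (\varepsilon>0),$$ and $\varepsilon'_n=2(\|\alpha\|_\infty+\|\gamma\|_\infty)\sin\frac{\pi}{2n}$. For non-empty bounded sets $S_n,S\subset\mathbb C$, $S_n\to S$ means that the Hausdorff distance of $S_n$ and $S$ tends to $0$ as $n\to\infty$; convergence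 below includes the assertion that the sets involved are non-empty and bounded. Then the following hold. 1. For all $n\in\mathbb N$ and $t\in\mathbb T$: $A^{\mathrm{per},t}_{n,k}=A^{\mathrm{per},t}_{n,0}$ for every $k\in\mathbb Z$; hence $\Pi^{n,t}_\varepsilon(A)=\mathrm{Spec}_\varepsilon A^{\mathrm{per},t}_{n,0}$ for $\varepsilon\ge0$ and $\pi^{n,t}_\varepsilon(A)=\mathrm{spec}_\varepsilon A^{\mathrm{per},t}_{n,0}$ for $\varepsilon>0$. 2. For every $t\in\mathbb T$ the $\pi$ method does not suffer from spectral pollution for $A$: there is a positive null sequence $(\eta_m)_{m\in\mathbb N}$ such that $\mathrm{spec}_\varepsilon A^{\mathrm{per},t}_{m,k}\subset\mathrm{spec}_{\varepsilon+\eta_m}A$ for all $\varepsilon>0$, $m\in\mathbb N$, $k\in\mathbb Z$. 3. For all $n\in\mathbb N$ and $\varepsilon>0$, $$\mathrm{Spec}\,A=\bigcup_{t\in\mathbb T}\mathrm{Spec}\,A^{\mathrm{per},t}_{n,0},\quad \mathrm{spec}_\varepsilon A=\bigcup_{t\in\mathbb T}\mathrm{spec}_\varepsilon A^{\mathrm{per},t}_{n,0},\quad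 \mathrm{Spec}_\varepsilon A=\bigcup_{t\in\mathbb T}\mathrm{Spec}_\varepsilon A^{\mathrm{per},t}_{n,0}.$$ 4. For every $t\in\mathbb T$, as $n\to\infty$, $$\Pi^{n,t}_{\varepsilon+\varepsilon'_n}(A)=\mathrm{Spec}_{\varepsilon+\varepsilon'_n}A^{\mathrm{per},t}_{n,0}\to\mathrm{Spec}_\varepsilon A\quad(\varepsilon\ge0),$$ in particular $\Pi^{n,t}_{\varepsilon'_n}(A)=\mathrm{Spec}_{\varepsilon'_n}A^{\mathrm{per},t}_{n,0}\to\mathrm{Spec}\,A$, and $$\pi^{n,t}_{\varepsilon+\varepsilon'_n}(A)=\mathrm{spec}_{\varepsilon+\varepsilon'_n}A^{\mathrm{per},t}_{n,0}\to\mathrm{spec}_\varepsilon A\quad(\varepsilon>0).$$ -/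

import Mathlib

open Filter Topology
open scoped ENNReal

noncomputable section

namespace PiMethod

section Pseudospectra

variable {Y : Type*} [NormedAddCommGroup Y] [NormedSpace ℂ Y]

open Classical in
/-- `‖B⁻¹‖ ∈ [0, ∞]`, with the convention that `‖B⁻¹‖ = ∞` if `B` is not invertible in `L(Y)`. -/
def invNorm (B : Y →L[ℂ] Y) : ℝ≥0∞ :=
  if IsUnit B then ENNReal.ofReal ‖Ring.inverse B‖ else ∞

/-- The closed `ε`-pseudospectrum `{λ : 1 / ‖(B - λ I)⁻¹‖ ≤ ε}`, with `1 / ∞ = 0`. For `ε = 0` it is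
the spectrum, see `Specn_zero`. -/
def Specn (ε : ℝ) (B : Y →L[ℂ] Y) : Set ℂ :=
  {l | (invNorm (B - l • ContinuousLinearMap.id ℂ Y))⁻¹ ≤ ENNReal.ofReal ε}

/-- The open `ε`-pseudospectrum `{λ : 1 / ‖(B - λ I)⁻¹‖ < ε}`, with `1 / ∞ = 0`. -/
def specn (ε : ℝ) (B : Y →L[ℂ] Y) : Set ℂ :=
  {l | (invNorm (B - l • ContinuousLinearMap.id ℂ Y))⁻¹ < ENNReal.ofReal ε}

theorem Specn_zero (B : Y →L[ℂ] Y) : Specn 0 B = spectrum ℂ B := by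
  classical
  ext l
  have h : IsUnit (B - l • ContinuousLinearMap.id ℂ Y) ↔
      IsUnit (algebraMap ℂ (Y →L[ℂ] Y) l - B) := by
    rw [← IsUnit.neg_iff, neg_sub, Algebra.algebraMap_eq_smul_one]
    rfl
  rw [spectrum.mem_iff, ← h]
  simp only [Specn, invNorm, Set.mem_ofPred_eq, ENNReal.ofReal_zero, nonpos_iff_eq_zero,
    ENNReal.inv_eq_zero]
  split_ifs with h1 <;> simp [h1]

end Pseudospectra

section Operators

variable {X : Type*} [NormedAddCommGroup X] [NormedSpace ℂ X]

/-- `E = ℓ²(ℤ, X)`. -/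
abbrev BiSeq (X : Type*) [NormedAddCommGroup X] : Type _ := lp (fun _ : ℤ => X) 2

/-- The `(i, j)` entry `a_{i,j} ∈ L(X)` of the matrix representation of `A ∈ L(E)`. -/
def entry (A : BiSeq X →L[ℂ] BiSeq X) (i j : ℤ) : X →L[ℂ] X :=
  (lp.evalCLM ℂ (fun _ : ℤ => X) 2 i).comp
    (A.comp (lp.singleContinuousLinearMap ℂ (fun _ : ℤ => X) 2 j))

theorem entry_apply (A : BiSeq X →L[ℂ] BiSeq X) (i j : ℤ) (x : X) :
    entry A i j x = A (lp.single 2 j x) i := rfl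

def IsTridiagonal (A : BiSeq X →L[ℂ] BiSeq X) : Prop :=
  ∀ i j : ℤ, 1 < |i - j| → entry A i j = 0

/-- Every diagonal of the matrix representation is constant. -/
def IsBlockLaurent (A : BiSeq X →L[ℂ] BiSeq X) : Prop :=
  ∀ d : ℤ, ∃ c : X →L[ℂ] X, ∀ j : ℤ, entry A (j + d) j = c

/-- The subdiagonal `α_j = a_{j+1,j}`. -/
def subdiag (A : BiSeq X →L[ℂ] BiSeq X) (j : ℤ) : X →L[ℂ] X := entry A (j + 1) j

/-- The superdiagonal `γ_j = a_{j-1,j}`. -/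
def superdiag (A : BiSeq X →L[ℂ] BiSeq X) (j : ℤ) : X →L[ℂ] X := entry A (j - 1) j

/-- The finite section `A_{n,k}`: rows and columns `k+1, …, k+n` of `A`. -/
def finSection (A : BiSeq X →L[ℂ] BiSeq X) (n : ℕ) (k : ℤ) :
    Matrix (Fin n) (Fin n) (X →L[ℂ] X) :=
  Matrix.of fun i j => entry A (k + 1 + (i : ℕ)) (k + 1 + (j : ℕ))

/-- The corner matrix `B_{n,k}^t`: `t α_k` in the first row and last column, plus
`conj(t) γ_{k+n+1}` in the last row and first column (these coincide for `n = 1`). -/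
def cornerMatrix (A : BiSeq X →L[ℂ] BiSeq X) (n : ℕ) (k : ℤ) (t : Circle) :
    Matrix (Fin n) (Fin n) (X →L[ℂ] X) :=
  Matrix.of fun i j =>
    (if (i : ℕ) = 0 ∧ (j : ℕ) + 1 = n then (t : ℂ) • subdiag A k else 0) +
    (if (i : ℕ) + 1 = n ∧ (j : ℕ) = 0 then
      (starRingEnd ℂ (t : ℂ)) • superdiag A (k + n + 1) else 0)

/-- The periodised finite section `A_{n,k}^{per,t} = A_{n,k} + B_{n,k}^t`. -/
def perSection (A : BiSeq X →L[ℂ] BiSeq X) (n : ℕ) (k : ℤ) (t : Circle) :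
    Matrix (Fin n) (Fin n) (X →L[ℂ] X) :=
  finSection A n k + cornerMatrix A n k t

/-- The operator on `Xⁿ`, with norm `(∑ ‖x_i‖²)^{1/2}`, given by multiplication by an `n × n` matrix
with entries in `L(X)`. -/
def matOp {n : ℕ} (M : Matrix (Fin n) (Fin n) (X →L[ℂ] X)) :
    PiLp 2 (fun _ : Fin n => X) →L[ℂ] PiLp 2 (fun _ : Fin n => X) :=
  ((PiLp.continuousLinearEquiv 2 ℂ (fun _ : Fin n => X)).symm :
      (Fin n → X) →L[ℂ] PiLp 2 (fun _ : Fin n => X)).comp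
    (ContinuousLinearMap.pi fun i =>
      ∑ j, (M i j).comp (PiLp.proj (𝕜 := ℂ) 2 (fun _ : Fin n => X) j))

theorem matOp_apply {n : ℕ} (M : Matrix (Fin n) (Fin n) (X →L[ℂ] X))
    (x : PiLp 2 (fun _ : Fin n => X)) (i : Fin n) : matOp M x i = ∑ j, M i j (x j) := by
  simp [matOp]

/-- The `π` method set `π^{n,t}_ε(A)`. -/
def piOpen (n : ℕ) (t : Circle) (ε : ℝ) (A : BiSeq X →L[ℂ] BiSeq X) : Set ℂ :=
  ⋃ k : ℤ, specn ε (matOp (perSection A n k t))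

/-- The `π` method set `Π^{n,t}_ε(A)`. -/
def piClosed (n : ℕ) (t : Circle) (ε : ℝ) (A : BiSeq X →L[ℂ] BiSeq X) : Set ℂ :=
  closure (⋃ k : ℤ, Specn ε (matOp (perSection A n k t)))

/-- The penalty `ε'_n = 2 (‖α‖_∞ + ‖γ‖_∞) sin (π / (2n))`. -/
def penalty (A : BiSeq X →L[ℂ] BiSeq X) (n : ℕ) : ℝ :=
  2 * ((⨆ j : ℤ, ‖subdiag A j‖) + ⨆ j : ℤ, ‖superdiag A j‖) * Real.sin (Real.pi / (2 * n))

/-- The `π` method with parameter `t` does not suffer from spectral pollution for `A`. -/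
def NoSpectralPollution (t : Circle) (A : BiSeq X →L[ℂ] BiSeq X) : Prop :=
  ∃ η : ℕ → ℝ, (∀ n, 0 < η n) ∧ Tendsto η atTop (𝓝 0) ∧
    ∀ ε : ℝ, 0 < ε → ∀ n : ℕ, 1 ≤ n → ∀ k : ℤ,
      specn ε (matOp (perSection A n k t)) ⊆ specn (ε + η n) A

end Operators

/-- Hausdorff convergence `S_n → T` of a sequence `(S_n)_{n ≥ 1}` of non-empty bounded subsets of `ℂ`
to a non-empty bounded subset `T`. -/
def HausdorffTendsto (S : ℕ → Set ℂ) (T : Set ℂ) : Prop :=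
  (∀ n : ℕ, 1 ≤ n → (S n).Nonempty ∧ Bornology.IsBounded (S n)) ∧
    (T.Nonempty ∧ Bornology.IsBounded T) ∧
    Tendsto (fun n => Metric.hausdorffDist (S n) T) atTop (𝓝 0)

end PiMethod

end

open PiMethod

/-! Everything reduces to the symbol `a(ω) = a₀ + ω⁻¹ a₁ + ω a₋₁`, a `p × p` matrix for each `ω ∈
𝕋`. The `t`-periodised section is a twisted block circulant, so a discrete Fourier transform turns
it into the orthogonal sum of the matrices `a(ω)` with `ω ^ n = t⁻¹`; the full operator corresponds
in the same way to all of `𝕋`. Hence both open pseudospectra have the form `symbLower A K ε`, with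
`K` the set of those `n` roots (`specn_matOp_perSection`) or `K = 𝕋` (`specn_eq_symbLower`).

Absence of pollution is then monotonicity in `K`, and the union formulae hold because the root sets
cover `𝕋` as `t` varies. Each point of `𝕋` is within `2 sin (π / (2n))` of an `n`-th root of `t⁻¹`,
and `a` is Lipschitz with constant `‖a₁‖ + ‖a₋₁‖`, so enlarging `ε` by the penalty recovers all of
`𝕋`. The enlarged sets for the section lie between the pseudospectra of `A` at levels `ε` and `ε +
ε'_n`, and compactness gives Hausdorff convergence.

Closed pseudospectra are intersections of open ones. The open case of the limit also needs the
closed pseudospectrum to lie in the closure of the open one, which follows from the maximum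
principle (`mem_closure_of_norm_le`). -/

namespace PiMethod

/-! ### Pseudospectra expressed through lower bounds. -/

section PseudospectraBasic

variable {Y : Type*} [NormedAddCommGroup Y] [NormedSpace ℂ Y]

theorem norm_ringInverse_le_iff {T : Y →L[ℂ] Y} (hT : IsUnit T) {ε : ℝ} (hε : 0 < ε) :
    ‖Ring.inverse T‖ ≤ ε⁻¹ ↔ ∀ x, ε * ‖x‖ ≤ ‖T x‖ := by
  have h1 : ∀ x, Ring.inverse T (T x) = x := fun x =>
    congrArg (fun S : Y →L[ℂ] Y => S x) (Ring.inverse_mul_cancel T hT)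
  have h2 : ∀ x, T (Ring.inverse T x) = x := fun x =>
    congrArg (fun S : Y →L[ℂ] Y => S x) (Ring.mul_inverse_cancel T hT)
  constructor
  · intro h x
    have := (Ring.inverse T).le_of_opNorm_le h (T x)
    rw [h1] at this
    calc ε * ‖x‖ ≤ ε * (ε⁻¹ * ‖T x‖) := by gcongr
      _ = ‖T x‖ := by field_simp
  · intro h
    refine ContinuousLinearMap.opNorm_le_bound _ (by positivity) fun y => ?_
    have := h (Ring.inverse T y)
    rw [h2] at this
    rw [inv_mul_eq_div, le_div_iff₀ hε]
    linarith

theorem notMem_specn_iff {B : Y →L[ℂ] Y} {ε : ℝ} (hε : 0 < ε) {l : ℂ} :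
    l ∉ specn ε B ↔ IsUnit (B - l • ContinuousLinearMap.id ℂ Y) ∧
      ∀ x, ε * ‖x‖ ≤ ‖(B - l • ContinuousLinearMap.id ℂ Y) x‖ := by
  by_cases h : IsUnit (B - l • ContinuousLinearMap.id ℂ Y)
  · rw [← norm_ringInverse_le_iff h hε]
    simp only [specn, invNorm, h, if_true, Set.mem_ofPred_eq, not_lt, true_and]
    rw [ENNReal.le_inv_iff_le_inv, ← ENNReal.ofReal_inv_of_pos hε,
      ENNReal.ofReal_le_ofReal_iff (by positivity)]
  · simp [specn, invNorm, h, hε]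

/-- Transfers results from open to closed pseudospectra; `ε = 0` is allowed, so the spectrum is
covered too. -/
theorem mem_Specn_iff_forall {B : Y →L[ℂ] Y} {ε : ℝ} (hε : 0 ≤ ε) {l : ℂ} :
    l ∈ Specn ε B ↔ ∀ δ, ε < δ → l ∈ specn δ B := by
  simp only [Specn, specn, Set.mem_ofPred_eq]
  constructor
  · exact fun h δ hδ => h.trans_lt ((ENNReal.ofReal_lt_ofReal_iff (hε.trans_lt hδ)).2 hδ)
  · intro h
    have h2 : Tendsto (fun δ => ENNReal.ofReal δ) (𝓝[>] ε) (𝓝 (ENNReal.ofReal ε)) :=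
      (ENNReal.continuous_ofReal.tendsto ε).mono_left nhdsWithin_le_nhds
    exact ge_of_tendsto h2 (eventually_mem_nhdsWithin.mono fun δ hδ => (h δ hδ).le)

theorem Specn_mono (B : Y →L[ℂ] Y) {ε δ : ℝ} (h : ε ≤ δ) : Specn ε B ⊆ Specn δ B :=
  fun _ hl => le_trans hl (ENNReal.ofReal_le_ofReal h)

theorem specn_mono (B : Y →L[ℂ] Y) {ε δ : ℝ} (h : ε ≤ δ) : specn ε B ⊆ specn δ B :=
  fun _ hl => lt_of_lt_of_le hl (ENNReal.ofReal_le_ofReal h)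

theorem specn_subset_Specn (ε : ℝ) (B : Y →L[ℂ] Y) : specn ε B ⊆ Specn ε B :=
  fun _ hl => le_of_lt (Set.mem_ofPred_eq ▸ hl)

theorem spectrum_subset_specn (B : Y →L[ℂ] Y) {ε : ℝ} (hε : 0 < ε) :
    spectrum ℂ B ⊆ specn ε B := by
  rw [← Specn_zero]
  exact fun l hl => (mem_Specn_iff_forall le_rfl).1 hl ε hε

theorem isUnit_of_boundedBelow [FiniteDimensional ℂ Y] {T : Y →L[ℂ] Y} {ε : ℝ} (hε : 0 < ε)
    (hT : ∀ x, ε * ‖x‖ ≤ ‖T x‖) : IsUnit T := by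
  have : CompleteSpace Y := FiniteDimensional.complete ℂ Y
  have hinj : Function.Injective T := by
    refine (injective_iff_map_eq_zero T).2 fun x hx => ?_
    have := hT x
    rw [hx, norm_zero] at this
    exact norm_le_zero_iff.1 (nonpos_of_mul_nonpos_right this hε)
  exact ContinuousLinearMap.isUnit_iff_bijective.2
    ⟨hinj, (LinearMap.injective_iff_surjective (f := T.toLinearMap)).1 hinj⟩

theorem mem_specn_iff_exists [FiniteDimensional ℂ Y] {B : Y →L[ℂ] Y} {ε : ℝ} (hε : 0 < ε)
    {l : ℂ} : l ∈ specn ε B ↔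
      ∃ x, ‖(B - l • ContinuousLinearMap.id ℂ Y) x‖ < ε * ‖x‖ := by
  rw [← not_iff_not, notMem_specn_iff hε]
  push Not
  exact ⟨fun h => h.2, fun h => ⟨isUnit_of_boundedBelow hε h, h⟩⟩

theorem exists_norm_eq_one_of_lt {T : Y →L[ℂ] Y} {ε : ℝ} {x : Y} (hx : ‖T x‖ < ε * ‖x‖) :
    ∃ v, ‖v‖ = 1 ∧ ‖T v‖ < ε := by
  have hx0 : x ≠ 0 := by rintro rfl; simp at hx
  have hn : 0 < ‖x‖ := norm_pos_iff.2 hx0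
  refine ⟨((‖x‖⁻¹ : ℝ) : ℂ) • x, ?_, ?_⟩
  · rw [norm_smul, Complex.norm_real, norm_inv, norm_norm, inv_mul_cancel₀ hn.ne']
  · rw [map_smul, norm_smul, Complex.norm_real, norm_inv, norm_norm, inv_mul_lt_iff₀ hn]
    linarith

end PseudospectraBasic

/-! ### Hilbert space: adjoints and the maximum principle. -/

section Hilbert

variable {H : Type*} [NormedAddCommGroup H] [InnerProductSpace ℂ H] [CompleteSpace H]

/-- Put `y = T x` and apply Cauchy–Schwarz to `‖T x‖² = ⟨x, T* T x⟩`. -/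
theorem boundedBelow_adjoint {T : H →L[ℂ] H} {ε : ℝ}
    (hs : Function.Surjective T) (hT : ∀ x, ε * ‖x‖ ≤ ‖T x‖) (y : H) :
    ε * ‖y‖ ≤ ‖ContinuousLinearMap.adjoint T y‖ := by
  obtain ⟨x, rfl⟩ := hs y
  by_cases h0 : T x = 0
  · simp [h0]
  have hn : 0 < ‖T x‖ := norm_pos_iff.2 h0
  have h1 : ‖T x‖ ^ 2 ≤ ‖x‖ * ‖ContinuousLinearMap.adjoint T (T x)‖ := by
    have := norm_inner_le_norm (𝕜 := ℂ) x (ContinuousLinearMap.adjoint T (T x))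
    rw [ContinuousLinearMap.adjoint_inner_right, inner_self_eq_norm_sq_to_K] at this
    simpa using this
  by_cases hε : ε ≤ 0
  · exact (mul_nonpos_of_nonpos_of_nonneg hε (norm_nonneg _)).trans (norm_nonneg _)
  have h2 := hT x
  push Not at hε
  refine le_of_mul_le_mul_right ?_ hn
  calc ε * ‖T x‖ * ‖T x‖ = ε * ‖T x‖ ^ 2 := by ring
    _ ≤ ε * (‖x‖ * ‖ContinuousLinearMap.adjoint T (T x)‖) := by gcongr
    _ = (ε * ‖x‖) * ‖ContinuousLinearMap.adjoint T (T x)‖ := by ring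
    _ ≤ ‖T x‖ * ‖ContinuousLinearMap.adjoint T (T x)‖ := by gcongr
    _ = _ := mul_comm _ _

/-- The bound for `T` gives injectivity and closed range; the bound for `T*` kills the orthogonal
complement of the range. -/
theorem isUnit_of_boundedBelow_adjoint {T : H →L[ℂ] H} {ε : ℝ} (hε : 0 < ε)
    (hT : ∀ x, ε * ‖x‖ ≤ ‖T x‖)
    (hT' : ∀ x, ε * ‖x‖ ≤ ‖ContinuousLinearMap.adjoint T x‖) : IsUnit T := by
  have hinj : ∀ S : H →L[ℂ] H, (∀ x, ε * ‖x‖ ≤ ‖S x‖) → ∀ x, S x = 0 → x = 0 := by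
    intro S hS x hx
    have := hS x
    rw [hx, norm_zero] at this
    exact norm_le_zero_iff.1 (nonpos_of_mul_nonpos_right this hε)
  refine ContinuousLinearMap.isUnit_iff_bijective.2
    ⟨(injective_iff_map_eq_zero T).2 (hinj T hT), ?_⟩
  have hcl : IsClosed (Set.range T) := by
    refine (ContinuousLinearMap.antilipschitz_of_bound T (K := ⟨ε⁻¹, by positivity⟩)
      fun x => ?_).isClosed_range T.uniformContinuous
    change ‖x‖ ≤ ε⁻¹ * ‖T x‖
    rw [inv_mul_eq_div, le_div_iff₀ hε]
    linarith [hT x]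
  have hbot : (T.range)ᗮ = ⊥ := by
    rw [ContinuousLinearMap.orthogonal_range, Submodule.eq_bot_iff]
    exact fun x hx => hinj _ hT' x hx
  have hcl' : IsClosed (T.range : Set H) := hcl
  have := hcl'.completeSpace_coe
  have htop : T.range = ⊤ := Submodule.orthogonal_eq_bot_iff.1 hbot
  exact LinearMap.range_eq_top.1 htop

/-- Otherwise the resolvent has norm at most `ε⁻¹` near `l`. Applied to `y = (B - l) v`, it is a
holomorphic function of norm at most `1` there, with the unit vector `v` as its value at `l`, so its
norm has a local maximum. -/
theorem mem_closure_of_norm_le [FiniteDimensional ℂ H] {B : H →L[ℂ] H} {ε : ℝ} (hε : 0 < ε)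
    {l : ℂ} {v : H} (hv : ‖v‖ = 1) (hl : ‖(B - l • ContinuousLinearMap.id ℂ H) v‖ ≤ ε) :
    l ∈ closure (specn ε B) := by
  by_contra hcon
  have hU : ∀ᶠ z in 𝓝 l, z ∉ specn ε B := by
    filter_upwards [isClosed_closure.isOpen_compl.mem_nhds hcon] with z hz hz'
    exact hz (subset_closure hz')
  set y := (B - l • ContinuousLinearMap.id ℂ H) v with hy
  have hR : ∀ z : ℂ, IsUnit (B - z • ContinuousLinearMap.id ℂ H) →
      ∀ x, Ring.inverse (B - z • ContinuousLinearMap.id ℂ H)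
        ((B - z • ContinuousLinearMap.id ℂ H) x) = x := fun z hz x =>
    congrArg (fun S : H →L[ℂ] H => S x) (Ring.inverse_mul_cancel _ hz)
  have hR' : ∀ z : ℂ, IsUnit (B - z • ContinuousLinearMap.id ℂ H) →
      ∀ x, (B - z • ContinuousLinearMap.id ℂ H)
        (Ring.inverse (B - z • ContinuousLinearMap.id ℂ H) x) = x := fun z hz x =>
    congrArg (fun S : H →L[ℂ] H => S x) (Ring.mul_inverse_cancel _ hz)
  have hl0 := (notMem_specn_iff hε).1 hU.self_of_nhds
  let f : ℂ → H := fun z => Ring.inverse (B - z • ContinuousLinearMap.id ℂ H) y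
  have hfl : f l = v := hR l hl0.1 v
  have hd : ∀ᶠ z in 𝓝 l, DifferentiableAt ℂ f z := by
    filter_upwards [hU] with z hz
    have h1 : DifferentiableAt ℂ (fun z : ℂ => B - z • ContinuousLinearMap.id ℂ H) z := by
      fun_prop
    obtain ⟨u, hu⟩ := ((notMem_specn_iff hε).1 hz).1
    have h2 : DifferentiableAt ℂ (Ring.inverse : (H →L[ℂ] H) → (H →L[ℂ] H))
        (B - z • ContinuousLinearMap.id ℂ H) := by
      rw [← hu]; exact differentiableAt_inverse u.isUnit
    have h3 := DifferentiableAt.comp z h2 h1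
    exact h3.clm_apply (differentiableAt_const y)
  have hmax : IsLocalMax (norm ∘ f) l := by
    filter_upwards [hU] with z hz
    obtain ⟨hz1, hz2⟩ := (notMem_specn_iff hε).1 hz
    have h1 := hz2 (f z)
    rw [hR' z hz1 y] at h1
    simp only [Function.comp_apply, hfl, hv]
    nlinarith
  have : UniformConvexSpace H :=
    let _ : InnerProductSpace ℝ H := InnerProductSpace.complexToReal
    InnerProductSpace.toUniformConvexSpace
  have : StrictConvexSpace ℝ H := inferInstance
  -- Strict convexity makes `f` itself locally constant, not only its norm. Then `(B - z) v = y = (B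
  -- - l) v` for all `z` near `l`, which forces `z = l`.
  have hconst := Complex.eventually_eq_of_isLocalMax_norm hd hmax
  have hev : ∀ᶠ z in 𝓝 l, z = l := by
    filter_upwards [hconst, hU] with z hz hz'
    have h1 := hR' z ((notMem_specn_iff hε).1 hz').1 y
    change (B - z • ContinuousLinearMap.id ℂ H) (f z) = y at h1
    rw [hz, hfl, hy] at h1
    simp only [sub_apply, smul_apply,
      ContinuousLinearMap.id_apply, sub_right_inj] at h1
    have hv0 : v ≠ 0 := by rintro rfl; simp at hv
    exact smul_left_injective ℂ hv0 h1
  have : ({l} : Set ℂ) ∈ 𝓝 l := hev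
  exact NeBot.ne (f := 𝓝[≠] l) inferInstance
    (mem_nhdsWithin_iff_exists_mem_nhds_inter.2 ⟨{l}, this, by simp⟩ |> empty_mem_iff_bot.1)

end Hilbert

/-! ### The symbol and its action on Fourier waves. -/

section Symbol

variable {X : Type*} [NormedAddCommGroup X] [NormedSpace ℂ X]

/-- The symbol `a₀ + ω⁻¹ a₁ + ω a₋₁` of a tridiagonal block Laurent operator, `ω ∈ 𝕋`. -/
noncomputable def symb (A : BiSeq X →L[ℂ] BiSeq X) (w : Circle) : X →L[ℂ] X :=
  entry A 0 0 + ((w⁻¹ : Circle) : ℂ) • entry A 1 0 + (w : ℂ) • entry A (-1) 0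

theorem IsBlockLaurent.entry_eq {A : BiSeq X →L[ℂ] BiSeq X} (hL : IsBlockLaurent A) (i j : ℤ) :
    entry A i j = entry A (i - j) 0 := by
  obtain ⟨c, hc⟩ := hL (i - j)
  have h1 := hc j
  have h2 := hc 0
  rw [add_sub_cancel] at h1
  rw [zero_add] at h2
  rw [h1, h2]

theorem IsBlockLaurent.perSection_eq {A : BiSeq X →L[ℂ] BiSeq X} (hL : IsBlockLaurent A)
    (k : ℤ) (n : ℕ) (t : Circle) : perSection A n k t = perSection A n 0 t := by
  ext1 i j
  simp only [perSection, finSection, cornerMatrix, subdiag, superdiag, Matrix.add_apply,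
    Matrix.of_apply]
  rw [hL.entry_eq (k + 1 + _), hL.entry_eq (0 + 1 + _), hL.entry_eq (k + 1) k,
    hL.entry_eq (0 + 1) 0, hL.entry_eq (k + n + 1 - 1), hL.entry_eq (0 + (n : ℤ) + 1 - 1),
    add_sub_add_left_eq_sub, add_sub_add_left_eq_sub, add_sub_cancel_left, add_sub_cancel_left,
    sub_sub_cancel_left, sub_sub_cancel_left]

/-- The matrix of the `t`-periodised shift on `n` points. -/
def cyclicShift {n : ℕ} (t : ℂ) (i j : Fin n) : ℂ :=
  (if (i : ℕ) = j + 1 then 1 else 0) + (if (i : ℕ) = 0 ∧ (j : ℕ) + 1 = n then t else 0)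

/-- The quasi-periodicity `hf` says that the corner entry supplies exactly the value of `f` beyond
the window. -/
theorem sum_cyclicShift_smul_left {n : ℕ} {V : Type*} [AddCommGroup V] [Module ℂ V] {t : ℂ}
    {f : ℤ → V} (hf : t • f 0 = f n) (j : Fin n) :
    ∑ i : Fin n, cyclicShift t i j • f (i : ℕ) = f ((j : ℕ) + 1) := by
  have hj := j.isLt
  by_cases h : (j : ℕ) + 1 = n
  · rw [Finset.sum_eq_single ⟨0, by omega⟩]
    · have h' : ((j : ℕ) : ℤ) + 1 = n := by exact_mod_cast h
      simpa [cyclicShift, h, h', show ¬ 0 = n by omega] using hf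
    · intro i _ hi
      have hi' : (i : ℕ) ≠ 0 := fun h0 => hi (Fin.ext h0)
      have := i.isLt
      simp [cyclicShift, hi', show ¬ (i : ℕ) = j + 1 by omega]
    · simp
  · rw [Finset.sum_eq_single ⟨j + 1, by omega⟩]
    · simp [cyclicShift]
    · intro i _ hi
      have hi' : (i : ℕ) ≠ j + 1 := fun h0 => hi (Fin.ext h0)
      simp [cyclicShift, hi', h]
    · simp

theorem sum_cyclicShift_smul_right {n : ℕ} {V : Type*} [AddCommGroup V] [Module ℂ V] {t : ℂ}
    {f : ℤ → V} (hf : t • f (n - 1) = f (-1)) (i : Fin n) :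
    ∑ j : Fin n, cyclicShift t i j • f (j : ℕ) = f ((i : ℕ) - 1) := by
  have hi := i.isLt
  by_cases h : (i : ℕ) = 0
  · rw [Finset.sum_eq_single ⟨n - 1, by omega⟩]
    · have h' : (((n - 1 : ℕ) : ℕ) : ℤ) = (n : ℤ) - 1 := by omega
      have h2 : n - 1 + 1 = n := by omega
      simpa [cyclicShift, h, h', h2, show ¬ 0 = n by omega] using hf
    · intro j _ hj
      have hj' : (j : ℕ) ≠ n - 1 := fun h0 => hj (Fin.ext h0)
      simp [cyclicShift, h, show ¬ (j : ℕ) + 1 = n by omega]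
    · simp
  · rw [Finset.sum_eq_single ⟨i - 1, by omega⟩]
    · have h' : (((i - 1 : ℕ) : ℕ) : ℤ) = (i : ℤ) - 1 := by omega
      have h2 : (i : ℕ) - 1 + 1 = i := by omega
      simp [cyclicShift, h, h', h2]
    · intro j _ hj
      have hj' : (j : ℕ) ≠ i - 1 := fun h0 => hj (Fin.ext h0)
      simp [cyclicShift, h, show ¬ (i : ℕ) = j + 1 by omega]
    · simp

/-- The section is `a₀ ⊗ I + a₁ ⊗ S + a₋₁ ⊗ S*` with `S` the twisted shift. For `n ≤ 2` corners and
diagonals overlap, but their contributions simply add. -/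
theorem perSection_apply {A : BiSeq X →L[ℂ] BiSeq X} (hA : IsTridiagonal A)
    (hL : IsBlockLaurent A) (n : ℕ) (t : Circle) (i j : Fin n) :
    perSection A n 0 t i j = (if i = j then entry A 0 0 else 0) +
      cyclicShift (t : ℂ) i j • entry A 1 0 +
      cyclicShift (starRingEnd ℂ (t : ℂ)) j i • entry A (-1) 0 := by
  have h1 : entry A (0 + 1 + ((i : ℕ) : ℤ)) (0 + 1 + ((j : ℕ) : ℤ)) =
      (if i = j then entry A 0 0 else 0) + (if (i : ℕ) = j + 1 then entry A 1 0 else 0) +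
      (if (j : ℕ) = i + 1 then entry A (-1) 0 else 0) := by
    rw [hL.entry_eq]
    by_cases hij : i = j
    · subst hij; simp
    have hij' : (i : ℕ) ≠ j := fun h => hij (Fin.ext h)
    by_cases h2 : (i : ℕ) = j + 1
    · rw [show (0 + 1 + ((i : ℕ) : ℤ)) - (0 + 1 + ((j : ℕ) : ℤ)) = 1 by omega]
      simp [hij, h2, show ¬ (j : ℕ) = j + 1 + 1 by omega]
    by_cases h3 : (j : ℕ) = i + 1
    · rw [show (0 + 1 + ((i : ℕ) : ℤ)) - (0 + 1 + ((j : ℕ) : ℤ)) = -1 by omega]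
      simp [hij, h3, show ¬ (i : ℕ) = i + 1 + 1 by omega]
    · rw [hA _ _ (by rw [lt_abs]; omega)]
      simp [hij, h2, h3]
  have h2 : subdiag A 0 = entry A 1 0 := by rw [subdiag, hL.entry_eq]; rfl
  have h3 : superdiag A (0 + n + 1) = entry A (-1) 0 := by
    rw [superdiag, hL.entry_eq]; congr 1; ring
  simp only [perSection, finSection, cornerMatrix, Matrix.add_apply, Matrix.of_apply, h1, h2, h3,
    cyclicShift, add_smul, ite_smul, one_smul, zero_smul, and_comm (a := (j : ℕ) = 0)]
  abel

/-- Only two boundary conditions are imposed on `f`, so this serves both quasi-periodic waves and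
sequences vanishing near the ends of the window. -/
theorem matOp_perSection_apply {A : BiSeq X →L[ℂ] BiSeq X} (hA : IsTridiagonal A)
    (hL : IsBlockLaurent A) {n : ℕ} {t : Circle} {f : ℤ → X}
    (h1 : (t : ℂ) • f (n - 1) = f (-1)) (h2 : starRingEnd ℂ (t : ℂ) • f 0 = f n) (i : Fin n) :
    matOp (perSection A n 0 t) (WithLp.toLp 2 fun i : Fin n => f (i : ℕ)) i =
      entry A 0 0 (f (i : ℕ)) + entry A 1 0 (f ((i : ℕ) - 1)) +
        entry A (-1) 0 (f ((i : ℕ) + 1)) := by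
  rw [matOp_apply, ← sum_cyclicShift_smul_right h1 i, ← sum_cyclicShift_smul_left h2 i]
  simp only [perSection_apply hA hL, add_apply, smul_apply, Finset.sum_add_distrib, map_sum,
    map_smul]
  congr 2
  rw [Finset.sum_eq_single i] <;> simp +contextual [eq_comm]

theorem circle_zpow_norm (w : Circle) (m : ℤ) : ‖(w : ℂ) ^ m‖ = 1 := by
  rw [norm_zpow, Circle.norm_coe, one_zpow]

/-- The row `(w⁻ⁱ)` is a left eigenvector of the twisted shift and of its adjoint; each Fourier
coefficient therefore intertwines the section with `symb A w`. -/
theorem sum_zpow_smul_matOp {A : BiSeq X →L[ℂ] BiSeq X} (hA : IsTridiagonal A)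
    (hL : IsBlockLaurent A) {n : ℕ} {t w : Circle} (hw : w ^ n = t⁻¹)
    (x : PiLp 2 (fun _ : Fin n => X)) :
    ∑ i : Fin n, (w : ℂ) ^ (-((i : ℕ) : ℤ)) • matOp (perSection A n 0 t) x i =
      symb A w (∑ i : Fin n, (w : ℂ) ^ (-((i : ℕ) : ℤ)) • x i) := by
  have hw0 : (w : ℂ) ≠ 0 := Circle.coe_ne_zero w
  have hwn : (w : ℂ) ^ n = (t : ℂ)⁻¹ := by rw [← Circle.coe_pow, hw, Circle.coe_inv]
  have e1 : ∀ j : Fin n, ∑ i : Fin n, cyclicShift (t : ℂ) i j • (w : ℂ) ^ (-((i : ℕ) : ℤ)) =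
      (w : ℂ) ^ (-(((j : ℕ) : ℤ) + 1)) := fun j =>
    sum_cyclicShift_smul_left (f := fun m => (w : ℂ) ^ (-m)) (by simp [hwn]) j
  have e2 : ∀ j : Fin n, ∑ i : Fin n,
      cyclicShift (starRingEnd ℂ (t : ℂ)) j i • (w : ℂ) ^ (-((i : ℕ) : ℤ)) =
      (w : ℂ) ^ (-(((j : ℕ) : ℤ) - 1)) := fun j =>
    sum_cyclicShift_smul_right (f := fun m => (w : ℂ) ^ (-m)) (by
      rw [neg_sub, sub_eq_add_neg, zpow_add₀ hw0, zpow_neg, zpow_natCast, hwn, inv_inv,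
        ← Circle.coe_inv_eq_conj]
      simp [mul_left_comm, Circle.coe_ne_zero]) j
  simp only [matOp_apply, Finset.smul_sum, map_sum, map_smul]
  rw [Finset.sum_comm]
  refine Finset.sum_congr rfl fun j _ => ?_
  have e3 : ∀ i : Fin n, (w : ℂ) ^ (-((i : ℕ) : ℤ)) • (perSection A n 0 t i j) (x j) =
      (if i = j then (w : ℂ) ^ (-((j : ℕ) : ℤ)) • entry A 0 0 (x j) else 0) +
      (cyclicShift (t : ℂ) i j • (w : ℂ) ^ (-((i : ℕ) : ℤ))) • entry A 1 0 (x j) +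
      (cyclicShift (starRingEnd ℂ (t : ℂ)) j i • (w : ℂ) ^ (-((i : ℕ) : ℤ))) •
        entry A (-1) 0 (x j) := by
    intro i
    rw [perSection_apply hA hL]
    split_ifs with h
    · subst h
      simp [smul_add, smul_smul, mul_comm]
    · simp [smul_add, smul_smul, mul_comm]
  simp only [e3, Finset.sum_add_distrib, ← Finset.sum_smul, e1, e2, symb, add_apply, smul_apply,
    smul_add, smul_smul, Circle.coe_inv]
  congr 3
  · simp
  · rw [neg_add, zpow_add₀ hw0, zpow_neg_one]
  · rw [neg_sub, sub_eq_add_neg, zpow_add₀ hw0, zpow_one, mul_comm]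

theorem matOp_perSection_wave {A : BiSeq X →L[ℂ] BiSeq X} (hA : IsTridiagonal A)
    (hL : IsBlockLaurent A) {n : ℕ} {t w : Circle} (hw : w ^ n = t⁻¹) (v : X) :
    matOp (perSection A n 0 t) (WithLp.toLp 2 fun i : Fin n => (w : ℂ) ^ ((i : ℕ) : ℤ) • v) =
      WithLp.toLp 2 fun i : Fin n => (w : ℂ) ^ ((i : ℕ) : ℤ) • symb A w v := by
  have hw0 : (w : ℂ) ≠ 0 := Circle.coe_ne_zero w
  have hwn : (w : ℂ) ^ n = (t : ℂ)⁻¹ := by rw [← Circle.coe_pow, hw, Circle.coe_inv]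
  ext i : 1
  rw [matOp_perSection_apply hA hL (f := fun m => (w : ℂ) ^ m • v)]
  · simp only [symb, add_apply, smul_apply, map_smul, smul_add, smul_smul, Circle.coe_inv]
    congr 3
    · rw [sub_eq_add_neg, zpow_add₀ hw0, zpow_neg_one]
  · rw [smul_smul, sub_eq_add_neg, zpow_add₀ hw0, zpow_natCast, hwn,
      mul_inv_cancel_left₀ (Circle.coe_ne_zero t)]
  · rw [zpow_natCast, hwn, zpow_zero, one_smul, ← Circle.coe_inv_eq_conj, Circle.coe_inv]

end Symbol

/-! ### Discrete Fourier transform at the `n`-th roots of a point of the circle. -/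

section Fourier

theorem exists_circle_pow_eq {n : ℕ} (hn : 1 ≤ n) (t : Circle) : ∃ w : Circle, w ^ n = t := by
  refine ⟨Circle.exp (Complex.arg t / n), ?_⟩
  have : (n : ℝ) ≠ 0 := by positivity
  rw [← Circle.exp_nsmul, nsmul_eq_mul, mul_div_cancel₀ _ this, Circle.exp_arg]

variable {X : Type*} [NormedAddCommGroup X] [InnerProductSpace ℂ X]

theorem sum_norm_sum_smul_sq {K I : Type*} [Fintype K] [Fintype I] [DecidableEq I] {c : K → I → ℂ}
    {r : ℝ}
    (hc : ∀ i j, ∑ k, starRingEnd ℂ (c k i) * c k j = if i = j then (r : ℂ) else 0) (x : I → X) :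
    ∑ k, ‖∑ i, c k i • x i‖ ^ 2 = r * ∑ i, ‖x i‖ ^ 2 := by
  have sq : ∀ y : X, ((‖y‖ : ℝ) : ℂ) ^ 2 = inner ℂ y y := fun y =>
    (inner_self_eq_norm_sq_to_K (𝕜 := ℂ) y).symm
  have h : ((∑ k, ‖∑ i, c k i • x i‖ ^ 2 : ℝ) : ℂ) = ((r * ∑ i, ‖x i‖ ^ 2 : ℝ) : ℂ) := by
    push_cast
    simp only [sq, sum_inner, inner_sum, inner_smul_left, inner_smul_right, Finset.mul_sum]
    rw [Finset.sum_comm]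
    calc ∑ i, ∑ k, ∑ j, c k i * (starRingEnd ℂ (c k j) * inner ℂ (x j) (x i))
        = ∑ i, ∑ j, (∑ k, starRingEnd ℂ (c k j) * c k i) * inner ℂ (x j) (x i) := by
          refine Finset.sum_congr rfl fun i _ => ?_
          rw [Finset.sum_comm]
          refine Finset.sum_congr rfl fun j _ => ?_
          rw [Finset.sum_mul]
          exact Finset.sum_congr rfl fun k _ => by ring
      _ = ∑ i, (r : ℂ) * inner ℂ (x i) (x i) := by
          simp [hc, ite_mul]
  exact_mod_cast h

/-- The roots are `u zᵏ` with `uⁿ = t` and `z` a primitive `n`-th root of unity; orthogonality is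
the vanishing of a geometric sum of ratio `z ^ (i - j)`. -/
theorem exists_parseval {n : ℕ} (hn : 1 ≤ n) (t : Circle) :
    ∃ W : Fin n → Circle, (∀ k, W k ^ n = t) ∧ ∀ x : Fin n → X,
      ∑ k, ‖∑ i : Fin n, (W k : ℂ) ^ (-((i : ℕ) : ℤ)) • x i‖ ^ 2 = n * ∑ i, ‖x i‖ ^ 2 := by
  obtain ⟨u, hu⟩ := exists_circle_pow_eq hn t
  have hn0 : (n : ℝ) ≠ 0 := by positivity
  have hz : IsPrimitiveRoot ((Circle.exp (2 * Real.pi / n) : Circle) : ℂ) n := by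
    have := Complex.isPrimitiveRoot_exp n (by omega)
    convert this using 1
    rw [Circle.coe_exp]
    push_cast
    ring_nf
  set z := Circle.exp (2 * Real.pi / n)
  have hzn : z ^ n = 1 := by
    apply Circle.ext
    rw [Circle.coe_pow, hz.pow_eq_one, Circle.coe_one]
  refine ⟨fun k => u * z ^ (k : ℕ), fun k => ?_, fun x => ?_⟩
  · rw [mul_pow, hu, ← pow_mul, mul_comm (k : ℕ), pow_mul, hzn, one_pow, mul_one]
  have key : ∀ i j : Fin n, ∑ k : Fin n,
      starRingEnd ℂ (((u * z ^ (k : ℕ) : Circle) : ℂ) ^ (-((i : ℕ) : ℤ))) *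
        ((u * z ^ (k : ℕ) : Circle) : ℂ) ^ (-((j : ℕ) : ℤ)) = if i = j then (n : ℂ) else 0 := by
    intro i j
    have e : ∀ k : ℕ, starRingEnd ℂ (((u * z ^ k : Circle) : ℂ) ^ (-((i : ℕ) : ℤ))) *
        ((u * z ^ k : Circle) : ℂ) ^ (-((j : ℕ) : ℤ)) =
        ((u ^ ((i : ℕ) - (j : ℕ) : ℤ) : Circle) : ℂ) *
          ((z ^ ((i : ℕ) - (j : ℕ) : ℤ) : Circle) : ℂ) ^ k := by
      intro k
      rw [← Circle.coe_zpow, ← Circle.coe_inv_eq_conj, ← Circle.coe_zpow, ← Circle.coe_mul,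
        ← Circle.coe_pow, ← Circle.coe_mul]
      congr 1
      rw [zpow_neg, inv_inv, ← zpow_add, ← sub_eq_add_neg, mul_zpow, ← zpow_natCast,
        ← zpow_natCast, ← zpow_mul, ← zpow_mul, mul_comm (k : ℤ)]
    simp only [e]
    rw [Fin.sum_univ_eq_sum_range (fun k => ((u ^ ((i : ℕ) - (j : ℕ) : ℤ) : Circle) : ℂ) *
      ((z ^ ((i : ℕ) - (j : ℕ) : ℤ) : Circle) : ℂ) ^ k), ← Finset.mul_sum]
    split_ifs with hij
    · subst hij; simp
    · have h1 : ((z ^ ((i : ℕ) - (j : ℕ) : ℤ) : Circle) : ℂ) ≠ 1 := by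
        intro h
        have h' : z ^ ((i : ℕ) - (j : ℕ) : ℤ) = 1 := Circle.ext (by rw [h, Circle.coe_one])
        rw [zpow_sub, zpow_natCast, zpow_natCast, mul_inv_eq_one] at h'
        refine hij (Fin.ext (hz.pow_inj i.isLt j.isLt ?_))
        rw [← Circle.coe_pow, h', Circle.coe_pow]
      have h2 : (z ^ ((i : ℕ) - (j : ℕ) : ℤ)) ^ n = 1 := by
        rw [← zpow_natCast, ← zpow_mul, mul_comm, zpow_mul, zpow_natCast, hzn, one_zpow]
      rw [geom_sum_eq h1, ← Circle.coe_pow, h2, Circle.coe_one, sub_self, zero_div, mul_zero]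
  exact sum_norm_sum_smul_sq key x

end Fourier

/-! ### Norms in `ℓ²` and lower bounds for the symbol. -/

section

variable {X : Type*} [NormedAddCommGroup X]

theorem BiSeq.norm_sq_eq_tsum (x : BiSeq X) : ‖x‖ ^ 2 = ∑' i, ‖x i‖ ^ 2 := by
  have := lp.norm_rpow_eq_tsum (p := 2) (by norm_num) x
  simpa using this

theorem BiSeq.sum_norm_sq_le (x : BiSeq X) (s : Finset ℤ) : ∑ i ∈ s, ‖x i‖ ^ 2 ≤ ‖x‖ ^ 2 := by
  have := lp.sum_rpow_le_norm_rpow (p := 2) (by norm_num) x s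
  simpa using this

theorem BiSeq.norm_sum_single_sq (f : ℤ → X) (s : Finset ℤ) :
    ‖∑ i ∈ s, (lp.single 2 i (f i) : BiSeq X)‖ ^ 2 = ∑ i ∈ s, ‖f i‖ ^ 2 := by
  have := lp.norm_sum_single (E := fun _ : ℤ => X) (p := 2) (by norm_num) f s
  simpa using this

end

/-- The `λ` for which some `symb A ω - λ`, `ω ∈ K`, maps a unit vector to one of norm `< ε`. -/
def symbLower {X : Type*} [NormedAddCommGroup X] [NormedSpace ℂ X] (A : BiSeq X →L[ℂ] BiSeq X)
    (K : Set Circle) (ε : ℝ) : Set ℂ :=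
  {l | ∃ w ∈ K, ∃ v : X, ‖v‖ = 1 ∧ ‖(symb A w - l • ContinuousLinearMap.id ℂ X) v‖ < ε}

section

variable {X : Type*} [NormedAddCommGroup X] [NormedSpace ℂ X]

theorem notMem_symbLower_iff {A : BiSeq X →L[ℂ] BiSeq X} {K : Set Circle} {ε : ℝ} {l : ℂ} :
    l ∉ symbLower A K ε ↔ ∀ w ∈ K, ∀ v, ε * ‖v‖ ≤
      ‖(symb A w - l • ContinuousLinearMap.id ℂ X) v‖ := by
  constructor
  · intro h w hw v
    by_contra! hcon
    exact h ⟨w, hw, exists_norm_eq_one_of_lt hcon⟩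
  · rintro h ⟨w, hw, v, hv, hlt⟩
    have := h w hw v
    rw [hv, mul_one] at this
    exact absurd hlt this.not_gt

theorem IsTridiagonal.apply_apply {A : BiSeq X →L[ℂ] BiSeq X} (hA : IsTridiagonal A)
    (hL : IsBlockLaurent A) (x : BiSeq X) (i : ℤ) :
    A x i = entry A 0 0 (x i) + entry A 1 0 (x (i - 1)) + entry A (-1) 0 (x (i + 1)) := by
  have h1 : HasSum (fun j => entry A i j (x j)) (A x i) :=
    (lp.hasSum_single (by norm_num) x).mapL ((lp.evalCLM ℂ (fun _ : ℤ => X) 2 i).comp A)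
  have h2 : HasSum (fun j => entry A i j (x j))
      (∑ j ∈ ({i, i - 1, i + 1} : Finset ℤ), entry A i j (x j)) := by
    refine hasSum_sum_of_ne_finset_zero fun j hj => ?_
    simp only [Finset.mem_insert, Finset.mem_singleton, not_or] at hj
    rw [hA i j (by rw [lt_abs]; omega), zero_apply]
  rw [h1.unique h2, Finset.sum_insert (by simp; omega), Finset.sum_insert (by simp; omega),
    Finset.sum_singleton, hL.entry_eq i i, hL.entry_eq i (i - 1), hL.entry_eq i (i + 1), add_assoc]
  congr 3 <;> ring_nf

theorem IsTridiagonal.apply_single {A : BiSeq X →L[ℂ] BiSeq X} (hA : IsTridiagonal A)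
    (hL : IsBlockLaurent A) (j : ℤ) (v : X) :
    A (lp.single 2 j v) = (lp.single 2 j (entry A 0 0 v) : BiSeq X) +
      lp.single 2 (j + 1) (entry A 1 0 v) + lp.single 2 (j - 1) (entry A (-1) 0 v) := by
  ext i
  rw [hA.apply_apply hL]
  simp only [lp.coeFn_add, Pi.add_apply, lp.coeFn_single]
  congr 2
  · by_cases h : i = j
    · subst h; simp
    · simp [h]
  · by_cases h : i = j + 1
    · subst h; simp
    · simp [h, show ¬ i - 1 = j by omega]
  · by_cases h : i = j - 1
    · subst h; simp
    · simp [h, show ¬ i + 1 = j by omega]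

end

/-! ### Pseudospectra of the periodised sections. -/

section FiniteSection

variable {X : Type*} [NormedAddCommGroup X] [InnerProductSpace ℂ X]

/-- By Parseval, it suffices to bound each Fourier coefficient, where the section acts as the
symbol. -/
theorem boundedBelow_matOp_perSection {A : BiSeq X →L[ℂ] BiSeq X} (hA : IsTridiagonal A)
    (hL : IsBlockLaurent A) {n : ℕ} (hn : 1 ≤ n) {t : Circle} {ε : ℝ} (hε : 0 < ε) {l : ℂ}
    (h : l ∉ symbLower A {w | w ^ n = t⁻¹} ε) (x : PiLp 2 (fun _ : Fin n => X)) :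
    ε * ‖x‖ ≤ ‖(matOp (perSection A n 0 t) - l • ContinuousLinearMap.id ℂ (PiLp 2 fun _ : Fin n => X)) x‖ := by
  rw [notMem_symbLower_iff] at h
  obtain ⟨W, hW, hP⟩ := exists_parseval (X := X) hn t⁻¹
  have hn0 : (0 : ℝ) < n := by positivity
  refine le_of_sq_le_sq ?_ (norm_nonneg _)
  rw [mul_pow, PiLp.norm_sq_eq_of_L2, PiLp.norm_sq_eq_of_L2]
  refine le_of_mul_le_mul_left ?_ hn0
  rw [← hP, mul_left_comm, ← hP, Finset.mul_sum]
  refine Finset.sum_le_sum fun k _ => ?_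
  have e : ∑ i : Fin n, (W k : ℂ) ^ (-((i : ℕ) : ℤ)) •
      ((matOp (perSection A n 0 t) - l • ContinuousLinearMap.id ℂ (PiLp 2 fun _ : Fin n => X)) x) i =
      (symb A (W k) - l • ContinuousLinearMap.id ℂ X)
        (∑ i : Fin n, (W k : ℂ) ^ (-((i : ℕ) : ℤ)) • x i) := by
    simp only [sub_apply, smul_apply, ContinuousLinearMap.id_apply, PiLp.sub_apply,
      PiLp.smul_apply, smul_sub, Finset.sum_sub_distrib]
    rw [sum_zpow_smul_matOp hA hL (hW k)]
    simp only [Finset.smul_sum, smul_comm l]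
  rw [e, ← mul_pow]
  exact pow_le_pow_left₀ (by positivity) (h _ (hW k) _) 2

/-- A vector `v` nearly annihilated by `symb A w - l` yields the wave `(wⁱ v)`, nearly annihilated
by the section; the scale factor `√n` cancels. -/
theorem specn_matOp_perSection [FiniteDimensional ℂ X] {A : BiSeq X →L[ℂ] BiSeq X}
    (hA : IsTridiagonal A) (hL : IsBlockLaurent A) {n : ℕ} (hn : 1 ≤ n) (t : Circle) {ε : ℝ}
    (hε : 0 < ε) :
    specn ε (matOp (perSection A n 0 t)) = symbLower A {w | w ^ n = t⁻¹} ε := by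
  ext l
  constructor
  · intro hl
    obtain ⟨x, hx⟩ := (mem_specn_iff_exists hε).1 hl
    by_contra hcon
    exact (boundedBelow_matOp_perSection hA hL hn hε hcon x).not_gt hx
  · rintro ⟨w, hw, v, hv, hlt⟩
    have hn0 : (0 : ℝ) < n := by positivity
    have hnorm : ∀ u : X, ‖WithLp.toLp 2 fun i : Fin n => (w : ℂ) ^ ((i : ℕ) : ℤ) • u‖ =
        √n * ‖u‖ := by
      intro u
      rw [PiLp.norm_eq_of_L2]
      simp only [norm_smul, circle_zpow_norm, one_mul, Finset.sum_const, Finset.card_univ,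
        Fintype.card_fin, nsmul_eq_mul]
      rw [Real.sqrt_mul (by positivity), Real.sqrt_sq (norm_nonneg _)]
    refine (mem_specn_iff_exists hε).2
      ⟨WithLp.toLp 2 fun i : Fin n => (w : ℂ) ^ ((i : ℕ) : ℤ) • v, ?_⟩
    have e : (matOp (perSection A n 0 t) - l • ContinuousLinearMap.id ℂ (PiLp 2 fun _ : Fin n => X))
        (WithLp.toLp 2 fun i : Fin n => (w : ℂ) ^ ((i : ℕ) : ℤ) • v) =
        WithLp.toLp 2 fun i : Fin n => (w : ℂ) ^ ((i : ℕ) : ℤ) •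
          (symb A w - l • ContinuousLinearMap.id ℂ X) v := by
      rw [sub_apply, matOp_perSection_wave hA hL hw]
      ext i : 1
      simp [smul_sub, smul_comm l]
    rw [e, hnorm, hnorm, hv, mul_one, mul_comm]
    gcongr

end FiniteSection

/-! ### Pseudospectra of the full operator. -/

section Laurent

variable {X : Type*} [NormedAddCommGroup X] [InnerProductSpace ℂ X]

/-- A finitely supported sequence does not notice periodisation over a long enough window, so the
bound for sections applies; density does the rest. -/
theorem boundedBelow_of_notMem_symbLower {A : BiSeq X →L[ℂ] BiSeq X} (hA : IsTridiagonal A)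
    (hL : IsBlockLaurent A) {ε : ℝ} (hε : 0 < ε) {l : ℂ} (h : l ∉ symbLower A Set.univ ε)
    (x : BiSeq X) : ε * ‖x‖ ≤ ‖(A - l • ContinuousLinearMap.id ℂ (BiSeq X)) x‖ := by
  have key : ∀ x : BiSeq X, ∀ m : ℕ, (∀ i : ℤ, (m : ℤ) < |i| → x i = 0) →
      ε * ‖x‖ ≤ ‖(A - l • ContinuousLinearMap.id ℂ (BiSeq X)) x‖ := by
    intro x m hx
    -- The window runs from `-m-1` to `m+1`, leaving a zero at each end of the support. The
    -- wrap-around terms then vanish, so the choice `t = 1` below is immaterial.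
    set n : ℕ := 2 * m + 3 with hn
    let s : ℤ := -m - 1
    let e : Fin n → ℤ := fun i => s + (i : ℕ)
    have he : Function.Injective e := fun i j hij => by
      apply Fin.ext; simpa [e] using hij
    let y : PiLp 2 (fun _ : Fin n => X) := WithLp.toLp 2 fun i => x (e i)
    have hl : l ∉ symbLower A {w | w ^ n = (1 : Circle)⁻¹} ε :=
      fun ⟨w, _, hw⟩ => h ⟨w, Set.mem_univ _, hw⟩
    have h1 := boundedBelow_matOp_perSection hA hL (by omega) hε hl y
    have hy : ‖y‖ = ‖x‖ := by
      refine (sq_eq_sq₀ (norm_nonneg _) (norm_nonneg _)).1 ?_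
      rw [PiLp.norm_sq_eq_of_L2, BiSeq.norm_sq_eq_tsum, ← he.tsum_eq, tsum_fintype]
      intro i hi
      have hi0 : x i ≠ 0 := fun h0 => hi (by simp [h0])
      have him : |i| ≤ m := by
        by_contra! hlt
        exact hi0 (hx i hlt)
      rw [abs_le] at him
      exact ⟨⟨(i - s).toNat, by omega⟩, by simp only [e]; omega⟩
    have hM : ‖(matOp (perSection A n 0 1) - l • ContinuousLinearMap.id ℂ (PiLp 2 fun _ : Fin n => X)) y‖ ≤
        ‖(A - l • ContinuousLinearMap.id ℂ (BiSeq X)) x‖ := by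
      refine le_of_sq_le_sq ?_ (norm_nonneg _)
      rw [PiLp.norm_sq_eq_of_L2]
      have hi : ∀ i : Fin n, ((matOp (perSection A n 0 1) -
          l • ContinuousLinearMap.id ℂ (PiLp 2 fun _ : Fin n => X)) y) i =
          ((A - l • ContinuousLinearMap.id ℂ (BiSeq X)) x) (e i) := by
        intro i
        have hz : ∀ i : ℤ, (m : ℤ) < |i| → x i = 0 := hx
        have := matOp_perSection_apply hA hL (n := n) (t := 1) (f := fun j => x (s + j))
          (by
            rw [hz (s + (n - 1)) (by rw [lt_abs]; omega), hz (s + -1) (by rw [lt_abs]; omega),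
              smul_zero])
          (by
            rw [hz (s + 0) (by rw [lt_abs]; omega), hz (s + n) (by rw [lt_abs]; omega),
              smul_zero]) i
        simp only [sub_apply, smul_apply, ContinuousLinearMap.id_apply, PiLp.sub_apply,
          PiLp.smul_apply, lp.coeFn_sub, lp.coeFn_smul, Pi.sub_apply, Pi.smul_apply]
        rw [hA.apply_apply hL]
        change matOp (perSection A n 0 1) (WithLp.toLp 2 fun i : Fin n => x (s + (i : ℕ))) i -
          l • x (e i) = _
        rw [this, ← add_sub_assoc, ← add_assoc]
      simp only [hi]
      have h2 := BiSeq.sum_norm_sq_le ((A - l • ContinuousLinearMap.id ℂ (BiSeq X)) x)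
        (Finset.univ.map ⟨e, he⟩)
      rw [Finset.sum_map] at h2
      exact h2
    rw [← hy]
    exact h1.trans hM
  have hlim := lp.hasSum_single (E := fun _ : ℤ => X) (p := 2) (by norm_num) x
  refine le_of_tendsto_of_tendsto' (hlim.norm.const_mul ε)
    (((ContinuousLinearMap.continuous _).tendsto _).comp hlim).norm fun F => ?_
  refine key _ (F.sup Int.natAbs) fun i hi => ?_
  have hiF : i ∉ F := fun hmem => by
    have := Finset.le_sup (f := Int.natAbs) hmem
    rw [Int.abs_eq_natAbs] at hi
    omega
  rw [lp.coeFn_sum, Finset.sum_apply]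
  refine Finset.sum_eq_zero fun j hj => lp.single_apply_ne _ _ _ ?_
  rintro rfl
  exact hiF hj

theorem entry_adjoint [CompleteSpace X] (A : BiSeq X →L[ℂ] BiSeq X) (i j : ℤ) :
    entry (ContinuousLinearMap.adjoint A) i j = ContinuousLinearMap.adjoint (entry A j i) := by
  refine (ContinuousLinearMap.eq_adjoint_iff _ _).2 fun x y => ?_
  have h1 := lp.inner_single_right (𝕜 := ℂ) i y (ContinuousLinearMap.adjoint A (lp.single 2 j x))
  have h2 := lp.inner_single_left (𝕜 := ℂ) j x (A (lp.single 2 i y))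
  rw [entry_apply, entry_apply, ← h1, ← h2, ContinuousLinearMap.adjoint_inner_left]

theorem IsTridiagonal.adjoint [CompleteSpace X] {A : BiSeq X →L[ℂ] BiSeq X}
    (hA : IsTridiagonal A) : IsTridiagonal (ContinuousLinearMap.adjoint A) := fun i j h => by
  rw [entry_adjoint, hA j i (by rwa [abs_sub_comm]), map_zero]

theorem IsBlockLaurent.adjoint [CompleteSpace X] {A : BiSeq X →L[ℂ] BiSeq X}
    (hL : IsBlockLaurent A) : IsBlockLaurent (ContinuousLinearMap.adjoint A) := fun d =>
  ⟨ContinuousLinearMap.adjoint (entry A (-d) 0), fun j => by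
    rw [entry_adjoint, hL.entry_eq, sub_add_cancel_left]⟩

theorem symb_adjoint [CompleteSpace X] {A : BiSeq X →L[ℂ] BiSeq X} (hL : IsBlockLaurent A)
    (w : Circle) :
    symb (ContinuousLinearMap.adjoint A) w = ContinuousLinearMap.adjoint (symb A w) := by
  simp only [symb, entry_adjoint, map_add, map_smulₛₗ]
  rw [hL.entry_eq 0 1, hL.entry_eq 0 (-1), ← Circle.coe_inv_eq_conj, ← Circle.coe_inv_eq_conj,
    inv_inv, zero_sub, zero_sub, neg_neg, add_right_comm]

/-- The adjoint is again tridiagonal block-Laurent, with symbol `a(w)*`. As `a(w) - l` is a square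
matrix, its lower bound passes to its adjoint, so the operator and its adjoint are both bounded
below. -/
theorem isUnit_sub_of_notMem_symbLower [FiniteDimensional ℂ X] {A : BiSeq X →L[ℂ] BiSeq X}
    (hA : IsTridiagonal A) (hL : IsBlockLaurent A) {ε : ℝ} (hε : 0 < ε) {l : ℂ}
    (h : l ∉ symbLower A Set.univ ε) : IsUnit (A - l • ContinuousLinearMap.id ℂ (BiSeq X)) := by
  have : CompleteSpace X := FiniteDimensional.complete ℂ X
  refine isUnit_of_boundedBelow_adjoint hε (boundedBelow_of_notMem_symbLower hA hL hε h) ?_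
  have hadj : ∀ {H : Type _} [NormedAddCommGroup H] [InnerProductSpace ℂ H] [CompleteSpace H]
      (B : H →L[ℂ] H), ContinuousLinearMap.adjoint (B - l • ContinuousLinearMap.id ℂ H) =
      ContinuousLinearMap.adjoint B - starRingEnd ℂ l • ContinuousLinearMap.id ℂ H := by
    intro H _ _ _ B
    rw [map_sub, map_smulₛₗ, ContinuousLinearMap.adjoint_id]
  rw [hadj]
  refine boundedBelow_of_notMem_symbLower hA.adjoint hL.adjoint hε ?_
  rw [notMem_symbLower_iff] at h ⊢
  intro w _ v
  rw [symb_adjoint hL, ← hadj]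
  have hw := h w (Set.mem_univ _)
  refine boundedBelow_adjoint ?_ hw v
  exact (ContinuousLinearMap.isUnit_iff_bijective.1 (isUnit_of_boundedBelow hε hw)).2

/-- On the infinite wave `A` acts as the symbol, so truncation leaves only boundary terms; the
induction telescopes to four of them. -/
theorem apply_sum_wave_sub {A : BiSeq X →L[ℂ] BiSeq X} (hA : IsTridiagonal A)
    (hL : IsBlockLaurent A) (w : Circle) (v : X) (N : ℕ) :
    A (∑ j ∈ Finset.range N, lp.single 2 (j : ℤ) ((w : ℂ) ^ (j : ℤ) • v)) -
      (∑ j ∈ Finset.range N, lp.single 2 (j : ℤ) ((w : ℂ) ^ (j : ℤ) • symb A w v) : BiSeq X) =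
    lp.single 2 (N : ℤ) ((w : ℂ) ^ ((N : ℤ) - 1) • entry A 1 0 v)
      - lp.single 2 (0 : ℤ) ((w : ℂ) ^ (-1 : ℤ) • entry A 1 0 v)
      + lp.single 2 (-1 : ℤ) (entry A (-1) 0 v)
      - lp.single 2 ((N : ℤ) - 1) ((w : ℂ) ^ (N : ℤ) • entry A (-1) 0 v) := by
  have hw0 : (w : ℂ) ≠ 0 := Circle.coe_ne_zero w
  induction N with
  | zero => simp
  | succ N ih =>
    rw [Finset.sum_range_succ, Finset.sum_range_succ, map_add, add_sub_add_comm, ih,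
      hA.apply_single hL]
    have e1 : (w : ℂ) ^ (N : ℤ) • (w : ℂ)⁻¹ • entry A 1 0 v =
        (w : ℂ) ^ ((N : ℤ) - 1) • entry A 1 0 v := by
      rw [smul_smul, sub_eq_add_neg, zpow_add₀ hw0, zpow_neg_one]
    have e2 : (w : ℂ) ^ (N : ℤ) • (w : ℂ) • entry A (-1) 0 v =
        (w : ℂ) ^ ((N : ℤ) + 1) • entry A (-1) 0 v := by
      rw [smul_smul, zpow_add₀ hw0, zpow_one]
    simp only [symb, add_apply, smul_apply, map_smul, smul_add, lp.single_add, Circle.coe_inv, e1,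
      e2]
    push_cast
    rw [add_sub_cancel_right]
    abel

/-- Test the bound on truncated waves of length `N`: the main terms grow like `√N`, while the
truncation error stays below the constant `C`. -/
theorem le_norm_symb_of_boundedBelow {A : BiSeq X →L[ℂ] BiSeq X} (hA : IsTridiagonal A)
    (hL : IsBlockLaurent A) {ε : ℝ} {l : ℂ}
    (h : ∀ x, ε * ‖x‖ ≤ ‖(A - l • ContinuousLinearMap.id ℂ (BiSeq X)) x‖) (w : Circle) (v : X) :
    ε * ‖v‖ ≤ ‖(symb A w - l • ContinuousLinearMap.id ℂ X) v‖ := by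
  set u := (symb A w - l • ContinuousLinearMap.id ℂ X) v with hu
  set C := 2 * ‖entry A 1 0 v‖ + 2 * ‖entry A (-1) 0 v‖
  let S : ℕ → X → BiSeq X := fun N y =>
    ∑ j ∈ Finset.range N, lp.single 2 (j : ℤ) ((w : ℂ) ^ (j : ℤ) • y)
  have hS : ∀ N y, ‖S N y‖ = √N * ‖y‖ := by
    intro N y
    rw [← Real.sqrt_sq (norm_nonneg (S N y)), ← Real.sqrt_sq (norm_nonneg y),
      ← Real.sqrt_mul (by positivity)]
    congr 1
    have := BiSeq.norm_sum_single_sq (fun j : ℤ => (w : ℂ) ^ j • y)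
      ((Finset.range N).map Nat.castEmbedding)
    simp only [Finset.sum_map, Nat.castEmbedding_apply, norm_smul, circle_zpow_norm, one_mul,
      Finset.sum_const, Finset.card_map, Finset.card_range, nsmul_eq_mul] at this
    exact this
  have hN : ∀ N : ℕ, √N * (ε * ‖v‖) ≤ √N * ‖u‖ + C := by
    intro N
    have e : (A - l • ContinuousLinearMap.id ℂ (BiSeq X)) (S N v) = S N u +
        (A (S N v) - S N (symb A w v)) := by
      simp only [hu, sub_apply, smul_apply, ContinuousLinearMap.id_apply, S, smul_sub,
        lp.single_sub, Finset.sum_sub_distrib, smul_comm _ l, lp.single_smul, Finset.smul_sum]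
      abel
    have h1 := h (S N v)
    have h2 : ‖A (S N v) - S N (symb A w v)‖ ≤ C := by
      rw [apply_sum_wave_sub hA hL]
      refine (norm_sub_le _ _).trans ?_
      refine (add_le_add_left ((norm_add_le _ _).trans
        (add_le_add_left (norm_sub_le _ _) _)) _).trans ?_
      simp only [lp.norm_single (E := fun _ : ℤ => X) (p := 2) (by norm_num), norm_smul,
        circle_zpow_norm, one_mul, C]
      linarith
    rw [hS] at h1
    calc √N * (ε * ‖v‖) = ε * (√N * ‖v‖) := by ring
      _ ≤ _ := h1
      _ ≤ ‖S N u‖ + ‖A (S N v) - S N (symb A w v)‖ := by rw [e]; exact norm_add_le _ _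
      _ ≤ √N * ‖u‖ + C := by rw [hS]; gcongr
  by_contra! hcon
  have hlim : Tendsto (fun N : ℕ => √N * (ε * ‖v‖ - ‖u‖)) atTop atTop :=
    (Real.tendsto_sqrt_atTop.comp tendsto_natCast_atTop_atTop).atTop_mul_const (by linarith)
  obtain ⟨N, hN'⟩ := (hlim.eventually_gt_atTop C).exists
  have := hN N
  linarith

theorem specn_eq_symbLower [FiniteDimensional ℂ X] {A : BiSeq X →L[ℂ] BiSeq X}
    (hA : IsTridiagonal A) (hL : IsBlockLaurent A) {ε : ℝ} (hε : 0 < ε) :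
    specn ε A = symbLower A Set.univ ε := by
  ext l
  rw [← not_iff_not, notMem_specn_iff hε]
  constructor
  · rintro ⟨_, h⟩
    rw [notMem_symbLower_iff]
    exact fun w _ v => le_norm_symb_of_boundedBelow hA hL h w v
  · exact fun h => ⟨isUnit_sub_of_notMem_symbLower hA hL hε h,
      boundedBelow_of_notMem_symbLower hA hL hε h⟩

end Laurent

/-! ### Approximation of the circle by roots, and compactness. -/

/-- Rotating `u` by `θ / n`, `|θ| ≤ π`, reaches a root; the chord has length `2 |sin (θ / (2n))|`.
This is the source of the sine in the penalty. -/
theorem exists_circle_pow_eq_near {n : ℕ} (hn : 1 ≤ n) (t u : Circle) :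
    ∃ w : Circle, w ^ n = t ∧ ‖(w : ℂ) - u‖ ≤ 2 * Real.sin (Real.pi / (2 * n)) := by
  have hn0 : (0 : ℝ) < n := by positivity
  have hn1 : (1 : ℝ) ≤ n := by exact_mod_cast hn
  set θ := Complex.arg ((t / u ^ n : Circle) : ℂ) with hθ
  refine ⟨u * Circle.exp (θ / n), ?_, ?_⟩
  · rw [mul_pow, ← Circle.exp_nsmul, nsmul_eq_mul, mul_div_cancel₀ _ hn0.ne', hθ, Circle.exp_arg,
      mul_div_cancel]
  · have h1 : ((u * Circle.exp (θ / n) : Circle) : ℂ) - u =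
        u * (Complex.exp (Complex.I * (θ / n : ℝ)) - 1) := by
      rw [Circle.coe_mul, Circle.coe_exp, mul_comm Complex.I]
      ring
    have hpi := Real.pi_pos
    have hle : |θ / n / 2| ≤ Real.pi / (2 * n) := by
      rw [div_div, abs_div, abs_of_pos (by positivity : (0 : ℝ) < n * 2), mul_comm (n : ℝ)]
      gcongr
      exact Complex.abs_arg_le_pi _
    have hle2 : Real.pi / (2 * n) ≤ Real.pi / 2 := by
      gcongr; linarith
    obtain ⟨ha, hb⟩ := abs_le.1 hle
    rw [h1, norm_mul, Circle.norm_coe, one_mul, Complex.norm_exp_I_mul_ofReal_sub_one, norm_mul,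
      Real.norm_ofNat, Real.norm_eq_abs]
    gcongr
    rw [abs_le, ← Real.sin_neg]
    exact ⟨Real.sin_le_sin_of_le_of_le_pi_div_two (by linarith) (by linarith) ha,
      Real.sin_le_sin_of_le_of_le_pi_div_two (by linarith) (by linarith) hb⟩

section SymbLower

variable {X : Type*} [NormedAddCommGroup X] [NormedSpace ℂ X]

theorem symbLower_shift {A : BiSeq X →L[ℂ] BiSeq X} {K : Set Circle} {ε : ℝ} {l m : ℂ}
    (hl : l ∈ symbLower A K ε) : m ∈ symbLower A K (ε + dist l m) := by
  obtain ⟨w, hw, v, hv, hlt⟩ := hl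
  refine ⟨w, hw, v, hv, ?_⟩
  have e : (symb A w - m • ContinuousLinearMap.id ℂ X) v =
      (symb A w - l • ContinuousLinearMap.id ℂ X) v + (l - m) • v := by
    simp only [sub_apply, smul_apply, ContinuousLinearMap.id_apply, sub_smul]
    abel
  rw [e]
  refine (norm_add_le _ _).trans_lt ?_
  rw [norm_smul, hv, mul_one, dist_eq_norm]
  gcongr

theorem norm_le_of_mem_symbLower {A : BiSeq X →L[ℂ] BiSeq X} {K : Set Circle} {ε : ℝ} {l : ℂ}
    (hl : l ∈ symbLower A K ε) :
    ‖l‖ ≤ ε + (‖entry A 0 0‖ + ‖entry A 1 0‖ + ‖entry A (-1) 0‖) := by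
  obtain ⟨w, hw, v, hv, hlt⟩ := hl
  have h1 : ‖symb A w‖ ≤ ‖entry A 0 0‖ + ‖entry A 1 0‖ + ‖entry A (-1) 0‖ := by
    refine (norm_add₃_le).trans_eq ?_
    rw [norm_smul, norm_smul, Circle.norm_coe, Circle.norm_coe, one_mul, one_mul]
  have h2 : ‖symb A w v‖ ≤ ‖symb A w‖ := by simpa [hv] using (symb A w).le_opNorm v
  have h3 : ‖l‖ = ‖l • v‖ := by rw [norm_smul, hv, mul_one]
  have h4 : ‖l • v‖ ≤ ‖symb A w v‖ + ‖(symb A w - l • ContinuousLinearMap.id ℂ X) v‖ := by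
    have : l • v = symb A w v - (symb A w - l • ContinuousLinearMap.id ℂ X) v := by simp
    rw [this]
    exact norm_sub_le _ _
  linarith

theorem norm_symb_sub_apply_le (A : BiSeq X →L[ℂ] BiSeq X) (w u : Circle) (v : X) :
    ‖symb A w v - symb A u v‖ ≤
      (‖entry A 1 0‖ + ‖entry A (-1) 0‖) * ‖(w : ℂ) - u‖ * ‖v‖ := by
  -- On the circle `w⁻¹` is the conjugate of `w`, so both differences have modulus `‖w - u‖`.
  have e : symb A w v - symb A u v = (starRingEnd ℂ ((w : ℂ) - u)) • entry A 1 0 v +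
      ((w : ℂ) - u) • entry A (-1) 0 v := by
    simp only [symb, add_apply, smul_apply, Circle.coe_inv_eq_conj, map_sub, sub_smul]
    abel
  rw [e]
  refine (norm_add_le _ _).trans ?_
  rw [norm_smul, norm_smul, RCLike.norm_conj]
  have h1 := (entry A 1 0).le_opNorm v
  have h2 := (entry A (-1) 0).le_opNorm v
  have h3 := norm_nonneg ((w : ℂ) - u)
  nlinarith [mul_le_mul_of_nonneg_left h1 h3, mul_le_mul_of_nonneg_left h2 h3]

theorem symbLower_subset_of_near {A : BiSeq X →L[ℂ] BiSeq X} {K : Set Circle} {r ε : ℝ}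
    (hK : ∀ u : Circle, ∃ w ∈ K, ‖(w : ℂ) - u‖ ≤ r) :
    symbLower A Set.univ ε ⊆
      symbLower A K (ε + (‖entry A 1 0‖ + ‖entry A (-1) 0‖) * r) := by
  rintro l ⟨u, -, v, hv, hlt⟩
  obtain ⟨w, hw, hwu⟩ := hK u
  refine ⟨w, hw, v, hv, ?_⟩
  have e : (symb A w - l • ContinuousLinearMap.id ℂ X) v =
      (symb A u - l • ContinuousLinearMap.id ℂ X) v + (symb A w v - symb A u v) := by
    simp only [sub_apply]
    abel
  rw [e]
  refine (norm_add_le _ _).trans_lt (add_lt_add_of_lt_of_le hlt ?_)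
  refine (norm_symb_sub_apply_le A w u v).trans ?_
  rw [hv, mul_one]
  gcongr

theorem symbLower_mono_set {A : BiSeq X →L[ℂ] BiSeq X} {K L : Set Circle} (h : K ⊆ L) (ε : ℝ) :
    symbLower A K ε ⊆ symbLower A L ε :=
  fun _ ⟨w, hw, hv⟩ => ⟨w, h hw, hv⟩

theorem symbLower_iUnion {A : BiSeq X →L[ℂ] BiSeq X} {ι : Type*} (K : ι → Set Circle) (ε : ℝ) :
    symbLower A (⋃ i, K i) ε = ⋃ i, symbLower A (K i) ε := by
  ext l
  simp only [symbLower, Set.mem_iUnion, Set.mem_ofPred_eq]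
  constructor
  · rintro ⟨w, ⟨i, hi⟩, hv⟩; exact ⟨i, w, hi, hv⟩
  · rintro ⟨i, w, hi, hv⟩; exact ⟨w, ⟨i, hi⟩, hv⟩

/-- The minimum over the compact set `K × unit sphere` is attained; a single `w` therefore works for
all `δ > ε`. -/
theorem exists_norm_le_of_forall_mem_symbLower [FiniteDimensional ℂ X]
    {A : BiSeq X →L[ℂ] BiSeq X} {K : Set Circle} (hK : IsClosed K) {ε : ℝ} {l : ℂ}
    (h : ∀ δ, ε < δ → l ∈ symbLower A K δ) :
    ∃ w ∈ K, ∃ v : X, ‖v‖ = 1 ∧ ‖(symb A w - l • ContinuousLinearMap.id ℂ X) v‖ ≤ ε := by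
  have : ProperSpace X := FiniteDimensional.proper ℂ X
  have hc : IsCompact (K ×ˢ Metric.sphere (0 : X) 1) := hK.isCompact.prod (isCompact_sphere 0 1)
  have hcont : Continuous fun q : Circle × X =>
      ‖(symb A q.1 - l • ContinuousLinearMap.id ℂ X) q.2‖ := by
    have h1 : Continuous fun q : Circle × X => ((q.1⁻¹ : Circle) : ℂ) := by fun_prop
    have h2 : Continuous fun q : Circle × X => (q.1 : ℂ) := by fun_prop
    refine Continuous.norm (Continuous.clm_apply ?_ continuous_snd)
    exact ((continuous_const.add (h1.smul continuous_const)).add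
      (h2.smul continuous_const)).sub continuous_const
  obtain ⟨w, hw, v, hv, -⟩ := h (ε + 1) (by linarith)
  obtain ⟨q, hq, hmin⟩ := hc.exists_isMinOn ⟨(w, v), hw, by simpa using hv⟩ hcont.continuousOn
  refine ⟨q.1, hq.1, q.2, by simpa using hq.2, le_of_forall_gt_imp_ge_of_dense fun δ hδ => ?_⟩
  obtain ⟨w, hw, v, hv, hlt⟩ := h δ hδ
  exact (hmin (show (w, v) ∈ K ×ˢ Metric.sphere (0 : X) 1 from ⟨hw, by simpa using hv⟩)).trans
    hlt.le

variable {Y : Type*} [NormedAddCommGroup Y] [NormedSpace ℂ Y]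

/-- The hypothesis `hB` covers `A` itself and all its periodised sections at once. -/
theorem isClosed_Specn_of_eq_symbLower {A : BiSeq X →L[ℂ] BiSeq X} {K : Set Circle}
    {B : Y →L[ℂ] Y} (hB : ∀ δ, 0 < δ → specn δ B = symbLower A K δ) {ε : ℝ} (hε : 0 ≤ ε) :
    IsClosed (Specn ε B) := by
  refine isClosed_of_closure_subset fun l hl => (mem_Specn_iff_forall hε).2 fun δ hδ => ?_
  obtain ⟨m, hm, hd⟩ := Metric.mem_closure_iff.1 hl ((δ - ε) / 2) (by linarith)
  have h1 := (mem_Specn_iff_forall hε).1 hm (ε + (δ - ε) / 2) (by linarith)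
  rw [hB _ (by linarith)] at h1
  have h2 := symbLower_shift (m := l) h1
  rw [dist_comm] at h2
  rw [← hB _ (by linarith [dist_nonneg (x := l) (y := m)])] at h2
  exact specn_mono B (by linarith) h2

theorem mem_Specn_iff_exists_of_eq_symbLower [FiniteDimensional ℂ X]
    {A : BiSeq X →L[ℂ] BiSeq X} {K : Set Circle} (hK : IsClosed K) {B : Y →L[ℂ] Y}
    (hB : ∀ δ, 0 < δ → specn δ B = symbLower A K δ) {ε : ℝ} (hε : 0 ≤ ε) {l : ℂ} :
    l ∈ Specn ε B ↔
      ∃ w ∈ K, ∃ v : X, ‖v‖ = 1 ∧ ‖(symb A w - l • ContinuousLinearMap.id ℂ X) v‖ ≤ ε := by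
  rw [mem_Specn_iff_forall hε]
  constructor
  · intro h
    refine exists_norm_le_of_forall_mem_symbLower hK fun δ hδ => ?_
    rw [← hB δ (by linarith)]
    exact h δ hδ
  · rintro ⟨w, hw, v, hv, hle⟩ δ hδ
    rw [hB δ (by linarith)]
    exact ⟨w, hw, v, hv, hle.trans_lt hδ⟩

theorem isBounded_Specn_of_eq_symbLower {A : BiSeq X →L[ℂ] BiSeq X} {K : Set Circle}
    {B : Y →L[ℂ] Y} (hB : ∀ δ, 0 < δ → specn δ B = symbLower A K δ) {ε : ℝ} (hε : 0 ≤ ε) :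
    Bornology.IsBounded (Specn ε B) := by
  refine isBounded_iff_forall_norm_le.2
    ⟨ε + 1 + (‖entry A 0 0‖ + ‖entry A 1 0‖ + ‖entry A (-1) 0‖), fun l hl => ?_⟩
  have := (mem_Specn_iff_forall hε).1 hl (ε + 1) (by linarith)
  rw [hB _ (by linarith)] at this
  exact norm_le_of_mem_symbLower this

end SymbLower

/-! ### Hausdorff convergence. -/

/-- As `δ` decreases to `ε`, the compact sets `Specn δ B` shrink to `Specn ε B`, so one of them
already lies in the open thickening. -/
theorem exists_Specn_subset_thickening {Y : Type*} [NormedAddCommGroup Y] [NormedSpace ℂ Y]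
    {B : Y →L[ℂ] Y} (hcl : ∀ δ, 0 ≤ δ → IsClosed (Specn δ B))
    (hbd : ∀ δ, 0 ≤ δ → Bornology.IsBounded (Specn δ B)) {ε r : ℝ} (hε : 0 ≤ ε) (hr : 0 < r) :
    ∃ δ, ε < δ ∧ Specn δ B ⊆ Metric.thickening r (Specn ε B) := by
  have hpos : ∀ δ : Set.Ioi ε, (0 : ℝ) ≤ δ := fun δ => hε.trans δ.2.le
  have : Nonempty (Set.Ioi ε) := ⟨⟨ε + 1, by simp⟩⟩
  obtain ⟨δ, hδ⟩ := exists_subset_nhds_of_isCompact' (V := fun δ : Set.Ioi ε => Specn (δ : ℝ) B)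
    (U := Metric.thickening r (Specn ε B))
    (fun a b => ⟨min a b, Specn_mono B (min_le_left _ _), Specn_mono B (min_le_right _ _)⟩)
    (fun δ => Metric.isCompact_of_isClosed_isBounded (hcl _ (hpos δ)) (hbd _ (hpos δ)))
    (fun δ => hcl _ (hpos δ)) (fun l hl => by
      refine Metric.isOpen_thickening.mem_nhds (Metric.self_subset_thickening hr _ ?_)
      refine (mem_Specn_iff_forall hε).2 fun δ hδ => ?_
      have h1 := Set.mem_iInter.1 hl ⟨(ε + δ) / 2, by simp only [Set.mem_Ioi]; linarith⟩
      exact (mem_Specn_iff_forall (by dsimp only; linarith)).1 h1 δ (by dsimp only; linarith))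
  exact ⟨δ, δ.2, hδ⟩

/-- One target `T` serves for both the closed and the open pseudospectrum; the two have the same
thickenings because `Specn ε B ⊆ closure T`. -/
theorem hausdorffTendsto_of_sandwich {Y : Type*} [NormedAddCommGroup Y] [NormedSpace ℂ Y]
    {B : Y →L[ℂ] Y} (hcl : ∀ δ, 0 ≤ δ → IsClosed (Specn δ B))
    (hbd : ∀ δ, 0 ≤ δ → Bornology.IsBounded (Specn δ B)) {ε : ℝ} (hε : 0 ≤ ε) {d : ℕ → ℝ}
    (hd0 : ∀ n, 0 ≤ d n) (hd : Tendsto d atTop (𝓝 0)) {S : ℕ → Set ℂ} {T : Set ℂ}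
    (hT0 : T.Nonempty) (hT : T ⊆ Specn ε B) (hT' : Specn ε B ⊆ closure T)
    (hTS : ∀ n, 1 ≤ n → T ⊆ S n) (hS : ∀ n, 1 ≤ n → S n ⊆ Specn (ε + d n) B) :
    HausdorffTendsto S T := by
  refine ⟨fun n hn => ⟨hT0.mono (hTS n hn), (hbd _ (add_nonneg hε (hd0 n))).subset (hS n hn)⟩,
    ⟨hT0, (hbd ε hε).subset hT⟩, ?_⟩
  rw [Metric.tendsto_atTop]
  intro r hr
  obtain ⟨δ, hδ, hsub⟩ := exists_Specn_subset_thickening hcl hbd hε (half_pos hr)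
  obtain ⟨N, hN⟩ := eventually_atTop.1 (hd.eventually_lt_const (sub_pos.2 hδ))
  refine ⟨max N 1, fun n hn => ?_⟩
  have hnN := hN n ((le_max_left _ _).trans hn)
  have hn1 : 1 ≤ n := (le_max_right _ _).trans hn
  rw [Real.dist_0_eq_abs, abs_of_nonneg Metric.hausdorffDist_nonneg]
  refine lt_of_le_of_lt (Metric.hausdorffDist_le_of_mem_dist (half_pos hr).le ?_ ?_)
    (half_lt_self hr)
  · intro l hl
    have h1 := Metric.thickening_subset_of_subset (r / 2) hT'
      (hsub (Specn_mono B (by linarith) (hS n hn1 hl)))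
    rw [Metric.thickening_closure] at h1
    obtain ⟨m, hm, hlm⟩ := Metric.mem_thickening_iff.1 h1
    exact ⟨m, hm, hlm.le⟩
  · exact fun l hl => ⟨l, hTS n hn1 hl, by rw [dist_self]; positivity⟩

/-! ### The penalty and the covering of the circle by root sets. -/

section Main

variable {X : Type*} [NormedAddCommGroup X] [NormedSpace ℂ X]

theorem IsBlockLaurent.penalty_eq {A : BiSeq X →L[ℂ] BiSeq X} (hL : IsBlockLaurent A) (n : ℕ) :
    penalty A n =
      (‖entry A 1 0‖ + ‖entry A (-1) 0‖) * (2 * Real.sin (Real.pi / (2 * n))) := by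
  have h1 : ∀ j, ‖subdiag A j‖ = ‖entry A 1 0‖ := fun j => by
    rw [subdiag, hL.entry_eq, add_sub_cancel_left]
  have h2 : ∀ j, ‖superdiag A j‖ = ‖entry A (-1) 0‖ := fun j => by
    rw [superdiag, hL.entry_eq, sub_sub_cancel_left]
  simp only [penalty, h1, h2, ciSup_const]
  ring

theorem penalty_nonneg (A : BiSeq X →L[ℂ] BiSeq X) (n : ℕ) : 0 ≤ penalty A n := by
  have h1 : 0 ≤ ⨆ j : ℤ, ‖subdiag A j‖ := Real.iSup_nonneg fun _ => norm_nonneg _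
  have h2 : 0 ≤ ⨆ j : ℤ, ‖superdiag A j‖ := Real.iSup_nonneg fun _ => norm_nonneg _
  have h3 : 0 ≤ Real.sin (Real.pi / (2 * n)) := by
    refine Real.sin_nonneg_of_nonneg_of_le_pi (by positivity) ?_
    -- At `n = 0` the quotient `π / (2n)` takes the default value `0`.
    rcases Nat.eq_zero_or_pos n with rfl | hn
    · simpa using Real.pi_pos.le
    · have : (1 : ℝ) ≤ n := by exact_mod_cast hn
      exact div_le_self Real.pi_pos.le (by linarith)
  rw [penalty]
  positivity

theorem tendsto_penalty (A : BiSeq X →L[ℂ] BiSeq X) : Tendsto (penalty A) atTop (𝓝 0) := by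
  have h1 : Tendsto (fun n : ℕ => Real.pi / (2 * (n : ℝ))) atTop (𝓝 0) :=
    tendsto_const_nhds.div_atTop
      (tendsto_natCast_atTop_atTop.const_mul_atTop (by norm_num : (0 : ℝ) < 2))
  have h2 := ((Real.continuous_sin.tendsto 0).comp h1).const_mul
    (2 * ((⨆ j : ℤ, ‖subdiag A j‖) + ⨆ j : ℤ, ‖superdiag A j‖))
  rw [Real.sin_zero, mul_zero] at h2
  exact h2

theorem isClosed_setOf_pow_eq (n : ℕ) (t : Circle) : IsClosed {w : Circle | w ^ n = t} :=
  isClosed_eq (continuous_pow n) continuous_const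

theorem iUnion_setOf_pow_eq_inv (n : ℕ) : ⋃ t : Circle, {w : Circle | w ^ n = t⁻¹} = Set.univ :=
  Set.eq_univ_of_forall fun w => Set.mem_iUnion.2 ⟨(w ^ n)⁻¹, by simp⟩

end Main

/-! ### Inclusions, union formulae and limits for `A` and its sections. -/

section Sections

variable {X : Type*} [NormedAddCommGroup X] [InnerProductSpace ℂ X] [FiniteDimensional ℂ X]

theorem specn_subset_specn_perSection {A : BiSeq X →L[ℂ] BiSeq X} (hA : IsTridiagonal A)
    (hL : IsBlockLaurent A) {n : ℕ} (hn : 1 ≤ n) (t : Circle) {ε : ℝ} (hε : 0 < ε) :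
    specn ε A ⊆ specn (ε + penalty A n) (matOp (perSection A n 0 t)) := by
  rw [specn_eq_symbLower hA hL hε,
    specn_matOp_perSection hA hL hn t (by linarith [penalty_nonneg A n]), hL.penalty_eq]
  exact symbLower_subset_of_near fun u => exists_circle_pow_eq_near hn t⁻¹ u

theorem Specn_subset_Specn_perSection {A : BiSeq X →L[ℂ] BiSeq X} (hA : IsTridiagonal A)
    (hL : IsBlockLaurent A) {n : ℕ} (hn : 1 ≤ n) (t : Circle) {ε : ℝ} (hε : 0 ≤ ε) :
    Specn ε A ⊆ Specn (ε + penalty A n) (matOp (perSection A n 0 t)) := by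
  intro l hl
  have hp := penalty_nonneg A n
  refine (mem_Specn_iff_forall (by linarith)).2 fun δ hδ => ?_
  have h1 := specn_subset_specn_perSection hA hL hn t (ε := δ - penalty A n) (by linarith)
    ((mem_Specn_iff_forall hε).1 hl _ (by linarith))
  rwa [sub_add_cancel] at h1

theorem specn_perSection_subset_specn {A : BiSeq X →L[ℂ] BiSeq X} (hA : IsTridiagonal A)
    (hL : IsBlockLaurent A) {n : ℕ} (hn : 1 ≤ n) (t : Circle) {ε : ℝ} (hε : 0 < ε) :
    specn ε (matOp (perSection A n 0 t)) ⊆ specn ε A := by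
  rw [specn_eq_symbLower hA hL hε, specn_matOp_perSection hA hL hn t hε]
  exact symbLower_mono_set (Set.subset_univ _) ε

theorem Specn_perSection_subset_Specn {A : BiSeq X →L[ℂ] BiSeq X} (hA : IsTridiagonal A)
    (hL : IsBlockLaurent A) {n : ℕ} (hn : 1 ≤ n) (t : Circle) {ε : ℝ} (hε : 0 ≤ ε) :
    Specn ε (matOp (perSection A n 0 t)) ⊆ Specn ε A := fun _ hl =>
  (mem_Specn_iff_forall hε).2 fun δ hδ => specn_perSection_subset_specn hA hL hn t
    (hε.trans_lt hδ) ((mem_Specn_iff_forall hε).1 hl δ hδ)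

theorem specn_eq_iUnion_perSection {A : BiSeq X →L[ℂ] BiSeq X} (hA : IsTridiagonal A)
    (hL : IsBlockLaurent A) {n : ℕ} (hn : 1 ≤ n) {ε : ℝ} (hε : 0 < ε) :
    specn ε A = ⋃ t : Circle, specn ε (matOp (perSection A n 0 t)) := by
  simp only [specn_matOp_perSection hA hL hn _ hε]
  rw [← symbLower_iUnion, iUnion_setOf_pow_eq_inv, specn_eq_symbLower hA hL hε]

/-- Attainment of the minimum matters: it gives one `w`, and this selects the single parameter `t =
w⁻ⁿ`. -/
theorem Specn_eq_iUnion_perSection {A : BiSeq X →L[ℂ] BiSeq X} (hA : IsTridiagonal A)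
    (hL : IsBlockLaurent A) {n : ℕ} (hn : 1 ≤ n) {ε : ℝ} (hε : 0 ≤ ε) :
    Specn ε A = ⋃ t : Circle, Specn ε (matOp (perSection A n 0 t)) := by
  refine Set.Subset.antisymm (fun l hl => ?_)
    (Set.iUnion_subset fun t => Specn_perSection_subset_Specn hA hL hn t hε)
  obtain ⟨w, -, hv⟩ := (mem_Specn_iff_exists_of_eq_symbLower isClosed_univ
    (fun _ => specn_eq_symbLower hA hL) hε).1 hl
  exact Set.mem_iUnion.2 ⟨(w ^ n)⁻¹, (mem_Specn_iff_exists_of_eq_symbLower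
    (isClosed_setOf_pow_eq n _) (fun _ => specn_matOp_perSection hA hL hn _) hε).2
    ⟨w, by simp, hv⟩⟩

/-- The maximum principle is applied to the single matrix `symb A w` at a minimising `w`, whose open
pseudospectrum lies in that of `A`. -/
theorem Specn_subset_closure_specn {A : BiSeq X →L[ℂ] BiSeq X} (hA : IsTridiagonal A)
    (hL : IsBlockLaurent A) {ε : ℝ} (hε : 0 < ε) : Specn ε A ⊆ closure (specn ε A) := by
  have : CompleteSpace X := FiniteDimensional.complete ℂ X
  intro l hl
  obtain ⟨w, -, v, hv, hle⟩ := (mem_Specn_iff_exists_of_eq_symbLower isClosed_univ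
    (fun _ => specn_eq_symbLower hA hL) hε.le).1 hl
  refine closure_mono ?_ (mem_closure_of_norm_le hε hv hle)
  intro m hm
  obtain ⟨x, hx⟩ := (mem_specn_iff_exists hε).1 hm
  rw [specn_eq_symbLower hA hL hε]
  exact ⟨w, Set.mem_univ _, exists_norm_eq_one_of_lt hx⟩

theorem noSpectralPollution {A : BiSeq X →L[ℂ] BiSeq X} (hA : IsTridiagonal A)
    (hL : IsBlockLaurent A) (t : Circle) : NoSpectralPollution t A := by
  -- The inclusion holds even without enlargement, so any positive null sequence will do.
  refine ⟨fun n => 1 / ((n : ℝ) + 1), fun n => by positivity,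
    tendsto_one_div_add_atTop_nhds_zero_nat, fun ε hε n hn k => ?_⟩
  rw [hL.perSection_eq]
  have h : (0 : ℝ) ≤ 1 / ((n : ℝ) + 1) := by positivity
  exact (specn_perSection_subset_specn hA hL hn t hε).trans (specn_mono A (by linarith))

theorem piClosed_eq {A : BiSeq X →L[ℂ] BiSeq X} (hA : IsTridiagonal A) (hL : IsBlockLaurent A)
    {n : ℕ} (hn : 1 ≤ n) (t : Circle) {ε : ℝ} (hε : 0 ≤ ε) :
    piClosed n t ε A = Specn ε (matOp (perSection A n 0 t)) := by
  simp only [piClosed, hL.perSection_eq _ n t, Set.iUnion_const]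
  exact (isClosed_Specn_of_eq_symbLower
    (fun _ => specn_matOp_perSection hA hL hn t) hε).closure_eq

theorem IsBlockLaurent.piOpen_eq {X : Type*} [NormedAddCommGroup X] [NormedSpace ℂ X]
    {A : BiSeq X →L[ℂ] BiSeq X} (hL : IsBlockLaurent A) (n : ℕ) (t : Circle) (ε : ℝ) :
    piOpen n t ε A = specn ε (matOp (perSection A n 0 t)) := by
  simp only [piOpen, hL.perSection_eq _ n t, Set.iUnion_const]

theorem Specn_nonempty [Nontrivial X] (A : BiSeq X →L[ℂ] BiSeq X) : (Specn 0 A).Nonempty := by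
  have : CompleteSpace X := FiniteDimensional.complete ℂ X
  obtain ⟨v, hv⟩ := exists_ne (0 : X)
  have : Nontrivial (BiSeq X) := ⟨⟨lp.single 2 0 v, 0, fun h => hv (by
    simpa using congrArg (fun x : BiSeq X => x 0) h)⟩⟩
  rw [Specn_zero]
  exact spectrum.nonempty A

theorem hausdorffTendsto_Specn [Nontrivial X] {A : BiSeq X →L[ℂ] BiSeq X}
    (hA : IsTridiagonal A) (hL : IsBlockLaurent A) (t : Circle) {ε : ℝ} (hε : 0 ≤ ε) :
    HausdorffTendsto (fun n => Specn (ε + penalty A n) (matOp (perSection A n 0 t)))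
      (Specn ε A) :=
  hausdorffTendsto_of_sandwich
    (fun _ => isClosed_Specn_of_eq_symbLower fun _ => specn_eq_symbLower hA hL)
    (fun _ => isBounded_Specn_of_eq_symbLower fun _ => specn_eq_symbLower hA hL)
    hε (penalty_nonneg A) (tendsto_penalty A) ((Specn_nonempty A).mono (Specn_mono A hε))
    subset_rfl subset_closure
    (fun _ hn => Specn_subset_Specn_perSection hA hL hn t hε)
    (fun n hn => Specn_perSection_subset_Specn hA hL hn t (add_nonneg hε (penalty_nonneg A n)))

theorem hausdorffTendsto_specn [Nontrivial X] {A : BiSeq X →L[ℂ] BiSeq X}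
    (hA : IsTridiagonal A) (hL : IsBlockLaurent A) (t : Circle) {ε : ℝ} (hε : 0 < ε) :
    HausdorffTendsto (fun n => specn (ε + penalty A n) (matOp (perSection A n 0 t)))
      (specn ε A) :=
  hausdorffTendsto_of_sandwich
    (fun _ => isClosed_Specn_of_eq_symbLower fun _ => specn_eq_symbLower hA hL)
    (fun _ => isBounded_Specn_of_eq_symbLower fun _ => specn_eq_symbLower hA hL)
    hε.le (penalty_nonneg A) (tendsto_penalty A)
    ((Specn_nonempty A).mono (by rw [Specn_zero]; exact spectrum_subset_specn A hε))
    (specn_subset_Specn ε A) (Specn_subset_closure_specn hA hL hε)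
    (fun _ hn => specn_subset_specn_perSection hA hL hn t hε)
    (fun n hn => (specn_perSection_subset_specn hA hL hn t
      (add_pos_of_pos_of_nonneg hε (penalty_nonneg A n))).trans (specn_subset_Specn _ A))

end Sections

end PiMethod

theorem theorem8p1 (p : ℕ) (hp : 1 ≤ p)
    (A : BiSeq (EuclideanSpace ℂ (Fin p)) →L[ℂ] BiSeq (EuclideanSpace ℂ (Fin p)))
    (hA : IsTridiagonal A) (hL : IsBlockLaurent A) :
    -- the periodised sections coincide, and the sets of the method are those of one section
    (∀ (k : ℤ) (n : ℕ), 1 ≤ n → ∀ t : Circle, perSection A n k t = perSection A n 0 t) ∧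
    (∀ n : ℕ, 1 ≤ n → ∀ t : Circle,
      (∀ ε : ℝ, 0 ≤ ε → piClosed n t ε A = Specn ε (matOp (perSection A n 0 t))) ∧
      (∀ ε : ℝ, 0 < ε → piOpen n t ε A = specn ε (matOp (perSection A n 0 t)))) ∧
    -- absence of spectral pollution
    (∀ t : Circle, NoSpectralPollution t A) ∧
    -- the union formulae
    (∀ n : ℕ, 1 ≤ n →
      spectrum ℂ A = ⋃ t : Circle, spectrum ℂ (matOp (perSection A n 0 t)) ∧
      ∀ ε : ℝ, 0 < ε →
        specn ε A = ⋃ t : Circle, specn ε (matOp (perSection A n 0 t)) ∧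
        Specn ε A = ⋃ t : Circle, Specn ε (matOp (perSection A n 0 t))) ∧
    -- Hausdorff convergence
    (∀ t : Circle,
      (∀ ε : ℝ, 0 ≤ ε →
        (∀ n : ℕ, 1 ≤ n → piClosed n t (ε + penalty A n) A =
          Specn (ε + penalty A n) (matOp (perSection A n 0 t))) ∧
        HausdorffTendsto
          (fun n => Specn (ε + penalty A n) (matOp (perSection A n 0 t))) (Specn ε A)) ∧
      ((∀ n : ℕ, 1 ≤ n → piClosed n t (penalty A n) A =
          Specn (penalty A n) (matOp (perSection A n 0 t))) ∧
        HausdorffTendsto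
          (fun n => Specn (penalty A n) (matOp (perSection A n 0 t))) (spectrum ℂ A)) ∧
      (∀ ε : ℝ, 0 < ε →
        (∀ n : ℕ, 1 ≤ n → piOpen n t (ε + penalty A n) A =
          specn (ε + penalty A n) (matOp (perSection A n 0 t))) ∧
        HausdorffTendsto
          (fun n => specn (ε + penalty A n) (matOp (perSection A n 0 t))) (specn ε A))) := by
  -- This is where `p ≥ 1` enters: a nontrivial space gives a non-empty spectrum, hence non-empty
  -- limit sets.
  have : Nontrivial (EuclideanSpace ℂ (Fin p)) :=
    Module.nontrivial_of_finrank_pos (R := ℂ) (by rw [finrank_euclideanSpace_fin]; omega)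
  refine ⟨fun k n _ t => hL.perSection_eq k n t, fun n hn t =>
    ⟨fun ε hε => piClosed_eq hA hL hn t hε, fun ε _ => hL.piOpen_eq n t ε⟩,
    noSpectralPollution hA hL, fun n hn => ⟨?_, fun ε hε =>
      ⟨specn_eq_iUnion_perSection hA hL hn hε, Specn_eq_iUnion_perSection hA hL hn hε.le⟩⟩,
    fun t => ⟨fun ε hε => ⟨fun n hn => ?_, hausdorffTendsto_Specn hA hL t hε⟩,
      ⟨fun n hn => piClosed_eq hA hL hn t (penalty_nonneg A n), ?_⟩,
      fun ε hε => ⟨fun n _ => hL.piOpen_eq n t _, hausdorffTendsto_specn hA hL t hε⟩⟩⟩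
  · simpa only [Specn_zero] using Specn_eq_iUnion_perSection hA hL hn le_rfl
  · exact piClosed_eq hA hL hn t (add_nonneg hε (penalty_nonneg A n))
  · simpa only [zero_add, Specn_zero] using hausdorffTendsto_Specn hA hL t le_rfl
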